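/- Let $\mathbb{D}=\{z\in\mathbb{C}:|z|<1\}$, $\mathbb{T}=(-\pi,\pi]$, and let $s(z,t)=\dfrac{1}{1-ze^{-it}}$ ($z\in\mathbb{D}$, $t\in\mathbb{T}$) be the Szegő kernel. Let $F$ be a probability measure on $\mathbb{T}$ and put $$K(z,w)=K_F(z,w)=\int_{\mathbb{T}} s(z,t)\,\overline{s(w,t)}\,F(dt)\qquad(z,w\in\mathbb{D}).$$ Let $X=\{X(z)\}_{z\in\mathbb{D}}$ be a Gaussian analytic function on $\mathbb{D}$ (a random function, almost surely analytic on $\mathbb{D}$, whose finite-dimensional distributions are centered, circularly symmetric complex Gaussian) with covariance $\mathbb{E}[X(z)\overline{X(w)}]=K_F(z,w)$. Then the first intensity of the zeros of $X$ is $$\rho_1(z)=\frac{1}{2\pi K(z,z)^2}\int_{\mathbb{T}^2}|e^{-it}-e^{-iu}|^2\,|s(z,t)s(z,u)|^4\,F(dt)F(du)\qquad(z\in\mathbb{D}).$$ That is, this $\rho_1$ is a nonnegative continuous function on $\mathbb{D}$, and for every Borel set $B\subseteq\mathbb{D}$ the number of zeros of $X$ in $B$, i.e. the mass of $B$ under the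 zero process $\sum_{z\in\mathbb{D}:X(z)=0}\delta_z$, is a random variable (up to null sets) with expectation $\int_B\rho_1(z)\,dz$, where $dz$ is Lebesgue measure on $\mathbb{C}$. -/

import Mathlib

open MeasureTheory ProbabilityTheory Set
open scoped ENNReal ComplexConjugate

noncomputable section

namespace GAFZeros

/-- The open unit disk `𝔻 = {z : |z| < 1}`. -/
abbrev disk : Set ℂ := Metric.ball (0 : ℂ) 1

/-- The circle, parametrized as the half-open interval `𝕋 = (-π, π]`. -/
abbrev Torus : Type := Set.Ioc (-Real.pi) Real.pi

/-- `e^{-it}`. -/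
def expNeg (t : Torus) : ℂ := Complex.exp (-(Complex.I * ((t : ℝ) : ℂ)))

/-- The Szegő kernel `s(z,t) = 1 / (1 - z e^{-it})`. -/
def szego (z : ℂ) (t : Torus) : ℂ := 1 / (1 - z * expNeg t)

/-- The kernel `K_F(z,w) = ∫_𝕋 s(z,t) * conj (s(w,t)) F(dt)`. -/
def spectralKernel (F : Measure Torus) (z w : ℂ) : ℂ :=
  ∫ t, szego z t * conj (szego w t) ∂F

variable {Ω : Type*} [MeasurableSpace Ω]

/-- `X` is a Gaussian analytic function on the unit disk under `P`: almost every path is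
holomorphic on `𝔻`, and the finite-dimensional distributions of `(X z)_{z ∈ 𝔻}` are centered
complex Gaussian.  As usual, "complex Gaussian" means circularly symmetric: jointly Gaussian real
and imaginary parts and `E[X(z) X(w)] = 0`.  Values of `X` outside `𝔻` play no role. -/
structure IsGAF (P : Measure Ω) (X : ℂ → Ω → ℂ) : Prop where
  holomorphic : ∀ᵐ ω ∂P, DifferentiableOn ℂ (fun z => X z ω) disk
  gaussian : IsGaussianProcess (fun z : disk => X (z : ℂ)) P
  centered : ∀ z ∈ disk, ∫ ω, X z ω ∂P = 0
  circular : ∀ z ∈ disk, ∀ w ∈ disk, ∫ ω, X z ω * X w ω ∂P = 0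

/-- The covariance kernel `K(z,w) = E[X(z) * conj (X(w))]`. -/
def covKernel (P : Measure Ω) (X : ℂ → Ω → ℂ) (z w : ℂ) : ℂ :=
  ∫ ω, X z ω * conj (X w ω) ∂P

/-- The mass that the zero process `∑_{z ∈ 𝔻, f z = 0} δ_z` gives to the set `B`, that is, the
number (possibly infinite) of points of `B ∩ 𝔻` at which `f` vanishes. -/
def zeroCount (f : ℂ → ℂ) (B : Set ℂ) : ℝ≥0∞ :=
  ((({z : ℂ | z ∈ disk ∧ f z = 0} ∩ B).encard : ℕ∞) : ℝ≥0∞)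

/-- `ρ` is the first intensity (1-point correlation function) of the zeros of `X` in `𝔻`: the
continuous nonnegative function on `𝔻` that is the density of the mean zero-counting measure
with respect to Lebesgue measure.  Continuity determines `ρ` at every point of `𝔻`.  The number of
zeros in a Borel set is required to be a genuine (a.e.-measurable) random variable. -/
structure IsFirstIntensity (P : Measure Ω) (X : ℂ → Ω → ℂ) (ρ : ℂ → ℝ) : Prop where
  nonneg : ∀ z ∈ disk, 0 ≤ ρ z
  continuousOn : ContinuousOn ρ disk
  aemeasurable_zeroCount : ∀ B : Set ℂ, MeasurableSet B →
    AEMeasurable (fun ω => zeroCount (fun z => X z ω) B) P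
  mean_zeroCount : ∀ B : Set ℂ, MeasurableSet B → B ⊆ disk →
    ∫⁻ ω, zeroCount (fun z => X z ω) B ∂P = ∫⁻ z in B, ENNReal.ofReal (ρ z)

end GAFZeros

end

noncomputable section

namespace GAFZeros

/-! ### Measurability of the number of zeros -/

/-! Since `szego 0` is the constant 1, the variable X(0) is a standard complex Gaussian, and m(z) =
K(z,0) is the mean of s(z,·) under F. Every s(z,t) has real part at least 1/2, so m has no zero on
the disk and X(z) = m(z)(V(z) + X(0)) with V(z) = X(z)/m(z) - X(0). On the spectral side V(z)
corresponds to s(z,·)/m(z) - 1, which has mean zero, hence is orthogonal to the constant 1. So the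
whole process V is independent of X(0) (`indepFun_increment`).

The zeros of X are therefore the points where -V takes the value X(0). Conditioning on V and
integrating out X(0), whose density is exp(-|w|²)/π, the area formula for holomorphic maps
(`lintegral_mul_encard_fiber`) gives the intensity E[|V'(z)|² exp(-|V(z)|²)]/π
(`lintegral_zeroCount_add_of_indepFun`).

For a centered circular Gaussian pair with E|V|² = a, E|V'|² = b and E[V' conj V] = c, that
expectation is b/(1+a) - |c|²/(1+a)² (`integral_norm_sq_mul_exp`). With G = s/m one has 1+a = ‖G‖²,
b = ‖G'‖² and c = ⟨G',G⟩ in L²(F), so the value is a Gram determinant over ‖G‖⁴. Lagrange's identity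
turns it into half a double integral of the Wronskian of t and u, in which the factor m contributes
only a scaling that cancels; this is `increment_energy`.

What remains is measurability of the zero count, the transfer of the moment formula to V' as a limit
of difference quotients, and the replacement of X by a version with every path holomorphic. -/

theorem measurableSet_exists_zero {α Y : Type*} [MeasurableSpace α] [TopologicalSpace Y]
    [SecondCountableTopology Y] {g : α → Y → ℝ} {K : Set Y} (hK : IsCompact K)
    (hg : ∀ a, ContinuousOn (g a) K) (hm : ∀ y ∈ K, Measurable fun a => g a y) :
    MeasurableSet {a | ∃ y ∈ K, g a y = 0} := by
  rcases K.eq_empty_or_nonempty with rfl | hne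
  · simp
  have : Nonempty K := hne.to_subtype
  -- On a compact set |g| attains its minimum, so a zero exists exactly when |g| has infimum 0 over
  -- a countable dense subset.
  have key : {a | ∃ y ∈ K, g a y = 0} =
      ⋂ n : ℕ, ⋃ i : ℕ, {a | |g a (TopologicalSpace.denseSeq K i)| < 1 / ((n : ℝ) + 1)} := by
    ext a
    simp only [mem_ofPred_eq, mem_iInter, mem_iUnion]
    have hc : Continuous fun y : K => |g a y| :=
      (continuousOn_iff_continuous_domRestrict.1 (hg a)).abs
    constructor
    · rintro ⟨y, hy, h0⟩ n
      have hU : IsOpen {y : K | |g a y| < 1 / ((n : ℝ) + 1)} := isOpen_lt hc continuous_const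
      obtain ⟨i, hi⟩ := (TopologicalSpace.denseRange_denseSeq K).exists_mem_open hU
        ⟨⟨y, hy⟩, by simpa [h0] using by positivity⟩
      exact ⟨i, hi⟩
    · intro h
      obtain ⟨y, hy, hmin⟩ := hK.exists_isMinOn hne (hg a).abs
      refine ⟨y, hy, ?_⟩
      by_contra h0
      obtain ⟨n, hn⟩ := exists_nat_one_div_lt (abs_pos.2 h0)
      obtain ⟨i, hi⟩ := h n
      exact absurd ((hn.trans_le (hmin (TopologicalSpace.denseSeq K i).2)).trans hi) (lt_irrefl _)
  rw [key]
  refine MeasurableSet.iInter fun n => MeasurableSet.iUnion fun i => ?_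
  exact measurableSet_lt (hm _ (TopologicalSpace.denseSeq K i).2).abs measurable_const

theorem natCast_le_encard_iff {β : Type*} {s : Set β} {k : ℕ} :
    (k : ℕ∞) ≤ s.encard ↔ ∃ z : Fin k → β, Function.Injective z ∧ ∀ i, z i ∈ s := by
  constructor
  · intro h
    obtain ⟨t, hts, ht⟩ := exists_subset_encard_eq h
    have hfin : t.Finite := finite_of_encard_eq_coe ht
    have hcard : Nat.card t = k := by
      have := hfin.cast_ncard_eq
      rw [ht] at this
      exact_mod_cast this
    have : Finite t := hfin
    let e := (Finite.equivFinOfCardEq hcard).symm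
    exact ⟨fun i => e i, Subtype.val_injective.comp e.injective, fun i => hts (e i).2⟩
  · rintro ⟨z, hz, hs⟩
    calc (k : ℕ∞) = (range z).encard := by
          rw [← image_univ, hz.injOn.encard_image]; simp
      _ ≤ s.encard := encard_le_encard (range_subset_iff.2 hs)

/-- Layer-cake form of a count. It reduces measurability of a number of points to that of the events
"at least k points". -/
theorem toENNReal_eq_tsum_indicator (n : ℕ∞) :
    (n : ℝ≥0∞) = ∑' k : ℕ, indicator {k : ℕ | ((k + 1 : ℕ) : ℕ∞) ≤ n} (fun _ => (1 : ℝ≥0∞)) k := by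
  classical
  simp only [indicator_apply, mem_ofPred_eq]
  induction n using ENat.recTopCoe with
  | top => simp
  | coe n =>
    rw [tsum_eq_sum (s := Finset.range n)]
    · rw [Finset.sum_congr rfl (g := fun _ => (1 : ℝ≥0∞))]
      · simp
      · intro k hk'
        rw [Finset.mem_range] at hk'
        rw [if_pos (by exact_mod_cast hk')]
    · intro k hk'
      rw [Finset.mem_range] at hk'
      rw [if_neg]
      intro h
      have : k + 1 ≤ n := by exact_mod_cast h
      omega

theorem measurable_encard_zeros_of_isCompact {α : Type*} [MeasurableSpace α] {f : α → ℂ → ℂ}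
    {C : Set ℂ} (hC : IsCompact C) (hf : ∀ a, ContinuousOn (f a) C)
    (hm : ∀ z ∈ C, Measurable fun a => f a z) :
    Measurable fun a => (((C ∩ {z | f a z = 0}).encard : ℕ∞) : ℝ≥0∞) := by
  have hk : ∀ k : ℕ, MeasurableSet {a | (k : ℕ∞) ≤ (C ∩ {z | f a z = 0}).encard} := by
    intro k
    -- Distinctness is not a closed condition on k-tuples, but separation by 1/(m+1) is. Having at
    -- least k zeros is thus a countable union of zero-existence events on compact sets.
    let K : ℕ → Set (Fin k → ℂ) := fun m =>
      (Set.pi univ fun _ => C) ∩ ⋂ i, ⋂ j, {z | i ≠ j → 1 / ((m : ℝ) + 1) ≤ dist (z i) (z j)}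
    have hKc : ∀ m, IsCompact (K m) := by
      intro m
      refine (isCompact_univ_pi fun _ => hC).inter_right ?_
      refine isClosed_iInter fun i => isClosed_iInter fun j => ?_
      by_cases hij : i = j
      · simp [hij]
      · simp only [ne_eq, hij, not_false_eq_true, forall_const]
        exact isClosed_le continuous_const (by fun_prop)
    have key : {a | (k : ℕ∞) ≤ (C ∩ {z | f a z = 0}).encard} =
        ⋃ m, {a | ∃ z ∈ K m, ∑ i, ‖f a (z i)‖ = 0} := by
      ext a
      simp only [mem_ofPred_eq, natCast_le_encard_iff, mem_iUnion]
      constructor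
      · rintro ⟨z, hz, hs⟩
        have : ∃ m : ℕ, ∀ p : Fin k × Fin k, p.1 ≠ p.2 →
            1 / ((m : ℝ) + 1) ≤ dist (z p.1) (z p.2) := by
          have : ∀ᶠ m : ℕ in Filter.atTop, ∀ p : Fin k × Fin k, p.1 ≠ p.2 →
            1 / ((m : ℝ) + 1) ≤ dist (z p.1) (z p.2) := by
            rw [Filter.eventually_all]
            intro p
            by_cases hp : p.1 = p.2
            · simp [hp]
            · filter_upwards [tendsto_one_div_add_atTop_nhds_zero_nat.eventually_le_const
                (dist_pos.2 (hz.ne hp))] with m hm' _ using hm'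
          exact this.exists
        obtain ⟨m, hm'⟩ := this
        refine ⟨m, z, ⟨fun i _ => (hs i).1, ?_⟩, ?_⟩
        · simp only [mem_iInter]
          exact fun i j hij => hm' (i, j) hij
        · exact Finset.sum_eq_zero fun i _ => by simpa using (hs i).2
      · rintro ⟨m, z, ⟨hzC, hzd⟩, h0⟩
        simp only [mem_iInter] at hzd
        refine ⟨z, fun i j hij => ?_, fun i => ⟨hzC i (mem_univ i), ?_⟩⟩
        · by_contra hne
          have h1 := hzd i j hne
          rw [hij, dist_self] at h1
          have : (0 : ℝ) < 1 / ((m : ℝ) + 1) := by positivity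
          linarith
        · have := (Finset.sum_eq_zero_iff_of_nonneg fun i _ => norm_nonneg (f a (z i))).1 h0 i
            (Finset.mem_univ i)
          simpa using this
    rw [key]
    refine MeasurableSet.iUnion fun m => measurableSet_exists_zero (hKc m) (fun a => ?_) ?_
    · refine continuousOn_finsetSum _ fun i _ => ContinuousOn.norm ?_
      exact (hf a).comp (by fun_prop) fun z hz => hz.1 i (mem_univ i)
    · intro z hz
      exact Finset.measurable_fun_sum _ fun i _ => (hm _ (hz.1 i (mem_univ i))).norm
  have heq : (fun a => (((C ∩ {z | f a z = 0}).encard : ℕ∞) : ℝ≥0∞)) = fun a => ∑' k : ℕ,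
      indicator {a | ((k + 1 : ℕ) : ℕ∞) ≤ (C ∩ {z | f a z = 0}).encard} (fun _ => (1 : ℝ≥0∞)) a :=
    funext fun a => toENNReal_eq_tsum_indicator _
  rw [heq]
  exact Measurable.tsum fun k => measurable_const.indicator (hk (k + 1))

theorem finite_zeros_of_isCompact {f : ℂ → ℂ} (hf : DifferentiableOn ℂ f disk)
    (h0 : ∃ z ∈ disk, f z ≠ 0) {C : Set ℂ} (hC : IsCompact C) (hCd : C ⊆ disk) :
    (C ∩ {z | f z = 0}).Finite := by
  by_contra hinf
  obtain ⟨x, hx, hacc⟩ := (Set.not_finite.1 hinf).exists_accPt_of_subset_isCompact hC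
    inter_subset_left
  obtain ⟨z, hz, hfz⟩ := h0
  refine hfz ((hf.analyticOnNhd Metric.isOpen_ball).eqOn_zero_of_preconnected_of_frequently_eq_zero
    (convex_ball _ _).isPreconnected (hCd hx) ?_ hz)
  rw [accPt_iff_frequently_nhdsNE] at hacc
  exact hacc.mono fun y hy => hy.2

/-- Closed sets form a π-system generating the Borel sets, and counting measure on the zeros in a
smaller closed ball is finite because the function is not identically zero. Measurability thus
passes from closed to Borel sets, and then to the disk by exhaustion. -/
theorem measurable_zeroCount_of_ne_zero {α : Type*} [MeasurableSpace α] {f : α → ℂ → ℂ}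
    (hf : ∀ a, DifferentiableOn ℂ (f a) disk) (hm : ∀ z ∈ disk, Measurable fun a => f a z)
    (h0 : ∀ a, ∃ z ∈ disk, f a z ≠ 0) {B : Set ℂ} (hB : MeasurableSet B) :
    Measurable fun a => zeroCount (f a) B := by
  let r : ℕ → ℝ := fun n => 1 - 1 / ((n : ℝ) + 1)
  have hr : ∀ n, Metric.closedBall (0 : ℂ) (r n) ⊆ disk := fun n =>
    Metric.closedBall_subset_ball (by
      simp only [r]
      linarith [Nat.one_div_pos_of_nat (α := ℝ) (n := n)])
  let Z : ℕ → α → Set ℂ := fun n a => Metric.closedBall (0 : ℂ) (r n) ∩ {z | f a z = 0}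
  have hZf : ∀ n a, (Z n a).Finite := fun n a =>
    finite_zeros_of_isCompact (hf a) (h0 a) (isCompact_closedBall _ _) (hr n)
  have hmeas : ∀ n, Measurable fun a => (Measure.count.restrict (Z n a) : Measure ℂ) := by
    intro n
    have hfin : ∀ a, IsFiniteMeasure (Measure.count.restrict (Z n a) : Measure ℂ) := fun a =>
      ⟨by rw [Measure.restrict_apply_univ]; exact Measure.count_apply_lt_top.2 (hZf n a)⟩
    have hcl : ∀ C : Set ℂ, IsClosed C →
        Measurable fun a => (Measure.count.restrict (Z n a) : Measure ℂ) C := by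
      intro C hC
      have := measurable_encard_zeros_of_isCompact (f := f)
        ((isCompact_closedBall (0 : ℂ) (r n)).inter_left hC)
        (fun a => (hf a).continuousOn.mono (inter_subset_right.trans (hr n)))
        (fun z hz => hm z (hr n hz.2))
      convert this using 2 with a
      rw [Measure.restrict_apply hC.measurableSet, ← Measure.count_apply]
      · simp only [Z, inter_assoc]
      · simpa only [Z, inter_assoc] using hC.measurableSet.inter (hZf n a).measurableSet
    exact Measurable.measure_of_isPiSystem
      ((borel_eq_generateFrom_isClosed (α := ℂ)).symm ▸ BorelSpace.measurable_eq)
      isPiSystem_isClosed hcl (hcl _ isClosed_univ)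
  have heq : (fun a => zeroCount (f a) B) = fun a => ⨆ n, Measure.count.restrict (Z n a) B := by
    ext a
    have hU : {z : ℂ | z ∈ disk ∧ f a z = 0} ∩ B = ⋃ n, B ∩ Z n a := by
      ext z
      simp only [mem_inter_iff, mem_ofPred_eq, mem_iUnion, Z]
      constructor
      · rintro ⟨⟨hz, h⟩, hzB⟩
        have hz' : 0 < 1 - ‖z‖ := by simpa [disk] using hz
        obtain ⟨n, hn⟩ := exists_nat_one_div_lt hz'
        exact ⟨n, hzB, by simp only [mem_closedBall_zero_iff, r]; linarith, h⟩
      · rintro ⟨n, hzB, hz, h⟩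
        exact ⟨⟨hr n hz, h⟩, hzB⟩
    have hmono : Monotone fun n => B ∩ Z n a := by
      intro n m hnm
      refine inter_subset_inter_right _ (inter_subset_inter_left _ ?_)
      refine Metric.closedBall_subset_closedBall ?_
      simp only [r]
      have := Nat.one_div_le_one_div (α := ℝ) hnm
      linarith
    have hms : ∀ n, MeasurableSet (B ∩ Z n a) := fun n => hB.inter (hZf n a).measurableSet
    rw [zeroCount, hU, ← Measure.count_apply (MeasurableSet.iUnion hms), hmono.measure_iUnion]
    simp_rw [Measure.restrict_apply hB]
  rw [heq]
  exact Measurable.iSup fun n => (Measure.measurable_coe hB).comp (hmeas n)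

theorem measurable_zeroCount {α : Type*} [MeasurableSpace α] {f : α → ℂ → ℂ}
    (hf : ∀ a, DifferentiableOn ℂ (f a) disk) (hm : ∀ z ∈ disk, Measurable fun a => f a z)
    {B : Set ℂ} (hB : MeasurableSet B) :
    Measurable fun a => zeroCount (f a) B := by
  classical
  have hE : MeasurableSet {a | ∀ z ∈ disk, f a z = 0} := by
    have hne : Nonempty disk := ⟨⟨0, by simp⟩⟩
    have : {a | ∀ z ∈ disk, f a z = 0} =
        ⋂ i : ℕ, {a | f a (TopologicalSpace.denseSeq disk i) = 0} := by
      ext a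
      simp only [mem_ofPred_eq, mem_iInter]
      refine ⟨fun h i => h _ (TopologicalSpace.denseSeq disk i).2, fun h z hz => ?_⟩
      have hc : Continuous fun y : disk => f a y :=
        continuousOn_iff_continuous_domRestrict.1 (hf a).continuousOn
      exact congrFun ((TopologicalSpace.denseRange_denseSeq disk).equalizer hc continuous_const
        (funext h)) ⟨z, hz⟩
    rw [this]
    exact MeasurableSet.iInter fun i =>
      hm _ (TopologicalSpace.denseSeq disk i).2 (measurableSet_singleton 0)
  -- Paths that vanish identically form a measurable event, on which the count is a constant; the
  -- constant path 1 replaces them.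
  let g : α → ℂ → ℂ := fun a z => if ∀ z ∈ disk, f a z = 0 then 1 else f a z
  have hg := measurable_zeroCount_of_ne_zero (f := g) (fun a => ?_) (fun z hz => ?_)
    (fun a => ?_) hB
  · have : (fun a => zeroCount (f a) B) = fun a =>
        if ∀ z ∈ disk, f a z = 0 then (((disk ∩ B).encard : ℕ∞) : ℝ≥0∞) else zeroCount (g a) B := by
      ext a
      split_ifs with h
      · have : {z : ℂ | z ∈ disk ∧ f a z = 0} = disk := by
          ext z; exact ⟨fun h' => h'.1, fun h' => ⟨h', h z h'⟩⟩
        rw [zeroCount, this]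
      · simp only [g, h, if_false]
    rw [this]
    exact Measurable.ite hE measurable_const hg
  · by_cases h : ∀ z ∈ disk, f a z = 0
    · have : g a = fun _ => 1 := funext fun z => if_pos h
      rw [this]
      fun_prop
    · simpa only [g, h, if_false] using hf a
  · exact Measurable.ite hE measurable_const (hm z hz)
  · by_cases h : ∀ z ∈ disk, f a z = 0
    · exact ⟨0, by simp, by rw [show g a 0 = 1 from if_pos h]; exact one_ne_zero⟩
    · simp only [g, h, if_false]
      push Not at h
      exact h

/-! ### The area formula for holomorphic functions -/

theorem toENNReal_encard_iUnion {β : Type*} {s : ℕ → Set β}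
    (hs : Pairwise (Function.onFun Disjoint s)) :
    (((⋃ n, s n).encard : ℕ∞) : ℝ≥0∞) = ∑' n, (((s n).encard : ℕ∞) : ℝ≥0∞) := by
  let _ : MeasurableSpace β := ⊤
  have := measure_iUnion (μ := Measure.count) hs fun n => MeasurableSpace.measurableSet_top
  rw [Measure.count_apply MeasurableSpace.measurableSet_top] at this
  rw [this]
  exact tsum_congr fun n => Measure.count_apply MeasurableSpace.measurableSet_top

theorem det_smul_one_real (c : ℂ) : (c • (1 : ℂ →L[ℝ] ℂ)).det = ‖c‖ ^ 2 := by
  have h : ((c • (1 : ℂ →L[ℝ] ℂ) : ℂ →L[ℝ] ℂ) : ℂ →ₗ[ℝ] ℂ) =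
      ((c • LinearMap.id : ℂ →ₗ[ℂ] ℂ) : ℂ →ₗ[ℝ] ℂ) := by
    ext; simp
  rw [ContinuousLinearMap.det, h, LinearMap.det_restrictScalars]
  simp [Algebra.norm_complex_eq, Complex.normSq_eq_norm_sq]

theorem exists_mem_nhds_injOn_of_deriv_ne_zero {φ : ℂ → ℂ} {U : Set ℂ} (hU : IsOpen U)
    (hφ : DifferentiableOn ℂ φ U) {z : ℂ} (hz : z ∈ U) (h : deriv φ z ≠ 0) :
    ∃ V, IsOpen V ∧ z ∈ V ∧ InjOn φ V := by
  have hs : HasStrictDerivAt φ (deriv φ z) z :=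
    (hφ.analyticAt (hU.mem_nhds hz)).hasStrictDerivAt
  have hs' := hs.hasStrictFDerivAt_equiv h
  exact ⟨(hs'.toOpenPartialHomeomorph φ).source, (hs'.toOpenPartialHomeomorph φ).open_source,
    hs'.mem_toOpenPartialHomeomorph_source, (hs'.toOpenPartialHomeomorph φ).injOn⟩

/-- The critical points have null image (the easy case of Sard), so almost every w has only regular
preimages. By Lindelöf the regular points split into countably many measurable pieces on which φ is
injective; on each one the change of variables applies with real Jacobian |φ'|². -/
theorem lintegral_mul_encard_fiber {φ : ℂ → ℂ} {U B : Set ℂ} (hU : IsOpen U)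
    (hφ : DifferentiableOn ℂ φ U) (hB : MeasurableSet B) (hBU : B ⊆ U) {g : ℂ → ℝ≥0∞}
    (hg : Measurable g) :
    ∫⁻ w, g w * (((B ∩ {z | φ z = w}).encard : ℕ∞) : ℝ≥0∞) =
      ∫⁻ z in B, ‖deriv φ z‖ₑ ^ 2 * g (φ z) := by
  have hder : ∀ S ⊆ U, ∀ z ∈ S, HasFDerivWithinAt φ (deriv φ z • (1 : ℂ →L[ℝ] ℂ)) S z :=
    fun S hS z hz => ((hφ.differentiableAt (hU.mem_nhds (hS hz))).hasDerivAt.complexToReal_fderiv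
      ).hasFDerivWithinAt
  set C : Set ℂ := B ∩ {z | deriv φ z = 0} with hC
  set R : Set ℂ := B \ C with hR
  have hCm : MeasurableSet C := hB.inter (measurable_deriv φ (measurableSet_singleton 0))
  have hRm : MeasurableSet R := hB.diff hCm
  have hCnull : volume (φ '' C) = 0 :=
    addHaar_image_eq_zero_of_det_fderivWithin_eq_zero volume
      (hder C (inter_subset_left.trans hBU)) fun z hz => by
        rw [det_smul_one_real, show deriv φ z = 0 from hz.2]; simp
  obtain ⟨V, hVo, hVi, hRV⟩ : ∃ V : ℕ → Set ℂ, (∀ n, IsOpen (V n)) ∧ (∀ n, InjOn φ (V n)) ∧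
      R ⊆ ⋃ n, V n := by
    have hex : ∀ z, ∃ V, IsOpen V ∧ InjOn φ V ∧ (z ∈ R → z ∈ V) := by
      intro z
      by_cases hz : z ∈ R
      · obtain ⟨V, h1, h2, h3⟩ := exists_mem_nhds_injOn_of_deriv_ne_zero hU hφ (hBU hz.1)
          (fun h => hz.2 ⟨hz.1, h⟩)
        exact ⟨V, h1, h3, fun _ => h2⟩
      · exact ⟨∅, isOpen_empty, injOn_empty _, fun h => absurd h hz⟩
    choose V h1 h2 h3 using hex
    obtain ⟨t, -, htc, htR⟩ := TopologicalSpace.countable_cover_nhdsWithin (s := R) (f := V)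
      fun z hz => mem_nhdsWithin_of_mem_nhds ((h1 z).mem_nhds (h3 z hz))
    rcases t.eq_empty_or_nonempty with rfl | hne
    · exact ⟨fun _ => ∅, fun _ => isOpen_empty, fun _ => injOn_empty _, by simpa using htR⟩
    · obtain ⟨e, rfl⟩ := htc.exists_eq_range hne
      exact ⟨fun n => V (e n), fun n => h1 _, fun n => h2 _, by simpa using htR⟩
  set D : ℕ → Set ℂ := fun n => R ∩ disjointed V n with hD
  have hDm : ∀ n, MeasurableSet (D n) := fun n =>
    hRm.inter (MeasurableSet.disjointed (fun n => (hVo n).measurableSet) n)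
  have hDd : Pairwise (Function.onFun Disjoint D) := fun i j hij =>
    (disjoint_disjointed V hij).mono inter_subset_right inter_subset_right
  have hDU : ⋃ n, D n = R := by
    rw [hD, ← inter_iUnion, iUnion_disjointed]
    exact inter_eq_left.2 hRV
  have hDi : ∀ n, InjOn φ (D n) := fun n =>
    (hVi n).mono (inter_subset_right.trans (disjointed_subset V n))
  have hDsub : ∀ n, D n ⊆ U := fun n => (inter_subset_left.trans sdiff_subset).trans hBU
  have himm : ∀ n, MeasurableSet (φ '' D n) := fun n =>
    (hDm n).image_of_continuousOn_injOn (hφ.continuousOn.mono (hDsub n)) (hDi n)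
  have hpiece : ∀ n w, (((D n ∩ {z | φ z = w}).encard : ℕ∞) : ℝ≥0∞) =
      (φ '' D n).indicator (fun _ => 1) w := by
    intro n w
    by_cases hw : w ∈ φ '' D n
    · obtain ⟨z, hz, rfl⟩ := hw
      have : D n ∩ {z' | φ z' = φ z} = {z} := by
        ext z'
        exact ⟨fun h => hDi n h.1 hz h.2, fun h => by rw [h]; exact ⟨hz, rfl⟩⟩
      rw [this, indicator_of_mem (mem_image_of_mem φ hz)]
      simp
    · have : D n ∩ {z | φ z = w} = ∅ := by
        ext z
        exact ⟨fun h => hw ⟨z, h.1, h.2⟩, fun h => h.elim⟩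
      rw [this, indicator_of_notMem hw]
      simp
  have hae : ∀ᵐ w, g w * (((B ∩ {z | φ z = w}).encard : ℕ∞) : ℝ≥0∞) =
      ∑' n, (φ '' D n).indicator g w := by
    filter_upwards [compl_mem_ae_iff.2 hCnull] with w hw
    have : B ∩ {z | φ z = w} = ⋃ n, D n ∩ {z | φ z = w} := by
      rw [← iUnion_inter, hDU]
      ext z
      exact ⟨fun h => ⟨⟨h.1, fun hz => hw ⟨z, hz, h.2⟩⟩, h.2⟩, fun h => ⟨h.1.1, h.2⟩⟩
    rw [this, toENNReal_encard_iUnion fun i j hij =>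
      (hDd hij).mono inter_subset_left inter_subset_left, ← ENNReal.tsum_mul_left]
    refine tsum_congr fun n => ?_
    rw [hpiece]
    by_cases hn : w ∈ φ '' D n <;> simp [hn]
  rw [lintegral_congr_ae hae, lintegral_tsum fun n => (hg.indicator (himm n)).aemeasurable]
  have hsplit : ∫⁻ z in B, ‖deriv φ z‖ₑ ^ 2 * g (φ z) = ∫⁻ z in R, ‖deriv φ z‖ₑ ^ 2 * g (φ z) := by
    rw [← lintegral_inter_add_sdiff _ B hCm, ← hR, setLIntegral_congr_fun (g := fun _ => 0)
      (hB.inter hCm) fun z hz => ?_]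
    · simp
    · simp only
      rw [show deriv φ z = 0 from hz.2.2]
      simp
  rw [hsplit, ← hDU, lintegral_iUnion hDm hDd]
  refine tsum_congr fun n => ?_
  rw [lintegral_indicator (himm n), lintegral_image_eq_lintegral_abs_det_fderiv_mul volume (hDm n)
    (hder _ (hDsub n)) (hDi n)]
  refine lintegral_congr fun z => ?_
  rw [det_smul_one_real, abs_of_nonneg (by positivity), ENNReal.ofReal_pow (norm_nonneg _),
    ofReal_norm]

/-! ### Circular Gaussian families with a spectral representation -/

/-- `Z` is a centered circularly symmetric complex Gaussian family whose covariances are the inner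
products of the functions `φ i` in `L²(F)`. -/
structure IsSpectral {Ω S T : Type*} [MeasurableSpace Ω] [MeasurableSpace S] (P : Measure Ω)
    (F : Measure S) (Z : T → Ω → ℂ) (φ : T → S → ℂ) : Prop where
  gaussian : IsGaussianProcess Z P
  centered : ∀ i, ∫ ω, Z i ω ∂P = 0
  circular : ∀ i j, ∫ ω, Z i ω * Z j ω ∂P = 0
  memLp : ∀ i, MemLp (φ i) 2 F
  cov : ∀ i j, ∫ ω, Z i ω * conj (Z j ω) ∂P = ∫ t, φ i t * conj (φ j t) ∂F

theorem integral_lin_comb_mul {Ω : Type*} [MeasurableSpace Ω] {P : Measure Ω}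
    {f₁ f₂ g₁ g₂ : Ω → ℂ} (hf₁ : MemLp f₁ 2 P) (hf₂ : MemLp f₂ 2 P) (hg₁ : MemLp g₁ 2 P)
    (hg₂ : MemLp g₂ 2 P) (a b c d : ℂ) :
    ∫ ω, (a * f₁ ω + b * f₂ ω) * (c * g₁ ω + d * g₂ ω) ∂P =
      a * c * ∫ ω, f₁ ω * g₁ ω ∂P + a * d * ∫ ω, f₁ ω * g₂ ω ∂P +
        b * c * ∫ ω, f₂ ω * g₁ ω ∂P + b * d * ∫ ω, f₂ ω * g₂ ω ∂P := by
  have h₁₁ : Integrable (fun ω => f₁ ω * g₁ ω) P := hf₁.integrable_mul hg₁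
  have h₁₂ : Integrable (fun ω => f₁ ω * g₂ ω) P := hf₁.integrable_mul hg₂
  have h₂₁ : Integrable (fun ω => f₂ ω * g₁ ω) P := hf₂.integrable_mul hg₁
  have h₂₂ : Integrable (fun ω => f₂ ω * g₂ ω) P := hf₂.integrable_mul hg₂
  have hsplit : ∀ ω, (a * f₁ ω + b * f₂ ω) * (c * g₁ ω + d * g₂ ω) =
      a * c * (f₁ ω * g₁ ω) + a * d * (f₁ ω * g₂ ω) + b * c * (f₂ ω * g₁ ω) +
        b * d * (f₂ ω * g₂ ω) := fun ω => by ring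
  simp_rw [hsplit]
  rw [integral_add (by fun_prop) (by fun_prop), integral_add (by fun_prop) (by fun_prop),
    integral_add (by fun_prop) (by fun_prop)]
  simp_rw [integral_const_mul]

theorem memLp_conj {Ω : Type*} [MeasurableSpace Ω] {P : Measure Ω} {f : Ω → ℂ} {p : ℝ≥0∞}
    (hf : MemLp f p P) : MemLp (fun ω => conj (f ω)) p P :=
  hf.star

theorem integral_lin_comb_mul_conj {Ω : Type*} [MeasurableSpace Ω] {P : Measure Ω}
    {f₁ f₂ g₁ g₂ : Ω → ℂ} (hf₁ : MemLp f₁ 2 P) (hf₂ : MemLp f₂ 2 P) (hg₁ : MemLp g₁ 2 P)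
    (hg₂ : MemLp g₂ 2 P) (a b c d : ℂ) :
    ∫ ω, (a * f₁ ω + b * f₂ ω) * conj (c * g₁ ω + d * g₂ ω) ∂P =
      a * conj c * ∫ ω, f₁ ω * conj (g₁ ω) ∂P + a * conj d * ∫ ω, f₁ ω * conj (g₂ ω) ∂P +
        b * conj c * ∫ ω, f₂ ω * conj (g₁ ω) ∂P + b * conj d * ∫ ω, f₂ ω * conj (g₂ ω) ∂P := by
  rw [← integral_lin_comb_mul hf₁ hf₂ (memLp_conj hg₁) (memLp_conj hg₂)]
  simp only [map_add, map_mul]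

/-! ### Linear combinations, covariances and independence. -/

namespace IsSpectral

variable {Ω S T T' : Type*} [MeasurableSpace Ω] [MeasurableSpace S] {P : Measure Ω}
  {F : Measure S} {Z : T → Ω → ℂ} {φ : T → S → ℂ}

theorem memLp_two (h : IsSpectral P F Z φ) (i : T) : MemLp (Z i) 2 P :=
  (h.gaussian.hasGaussianLaw_eval i).memLp_two

theorem integral_norm_sq (h : IsSpectral P F Z φ) (i : T) :
    ∫ ω, ‖Z i ω‖ ^ 2 ∂P = ∫ t, ‖φ i t‖ ^ 2 ∂F := by
  have := h.cov i i
  simp only [Complex.mul_conj, Complex.normSq_eq_norm_sq] at this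
  rw [integral_complex_ofReal, integral_complex_ofReal] at this
  exact_mod_cast this

/-- Increments, difference quotients and regression residuals are all two-term combinations, so this
single closure property, with free reindexing, covers every family used later. -/
theorem lin_comb (h : IsSpectral P F Z φ) (a b : T' → ℂ) (i j : T' → T) :
    IsSpectral P F (fun k ω => a k * Z (i k) ω + b k * Z (j k) ω)
      (fun k t => a k * φ (i k) t + b k * φ (j k) t) where
  gaussian := by
    classical
    refine ⟨fun I => ?_⟩
    let J : Finset T := I.image i ∪ I.image j
    have hi : ∀ k : I, i k ∈ J := fun k => Finset.mem_union_left _ (Finset.mem_image_of_mem i k.2)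
    have hj : ∀ k : I, j k ∈ J := fun k => Finset.mem_union_right _ (Finset.mem_image_of_mem j k.2)
    let L : (J → ℂ) →L[ℝ] (I → ℂ) := ContinuousLinearMap.pi fun k =>
      (a k • (1 : ℂ →L[ℝ] ℂ)) ∘L ContinuousLinearMap.proj ⟨i k, hi k⟩ +
      (b k • (1 : ℂ →L[ℝ] ℂ)) ∘L ContinuousLinearMap.proj ⟨j k, hj k⟩
    convert! (h.gaussian.hasGaussianLaw J).map L using 1
  centered k := by
    have := h.gaussian.isProbabilityMeasure
    rw [integral_add (((h.memLp_two _).integrable one_le_two).const_mul _)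
      (((h.memLp_two _).integrable one_le_two).const_mul _), integral_const_mul,
      integral_const_mul, h.centered, h.centered]
    simp
  circular k l := by
    rw [integral_lin_comb_mul (h.memLp_two _) (h.memLp_two _) (h.memLp_two _) (h.memLp_two _)]
    simp [h.circular]
  memLp k := ((h.memLp _).const_mul _).add ((h.memLp _).const_mul _)
  cov k l := by
    rw [integral_lin_comb_mul_conj (h.memLp_two _) (h.memLp_two _) (h.memLp_two _) (h.memLp_two _),
      integral_lin_comb_mul_conj (h.memLp _) (h.memLp _) (h.memLp _) (h.memLp _)]
    simp [h.cov]

/-- A product of two real parts is half the real part of a Hermitian plus a pseudo-covariance term,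
and circularity kills the latter. Orthogonality in L²(F) therefore makes all real covariances
vanish, which for jointly Gaussian variables is independence. -/
theorem covariance_inner (h : IsSpectral P F Z φ) (i j : T) (x y : ℂ) :
    cov[fun ω => inner ℝ x (Z i ω), fun ω => inner ℝ y (Z j ω); P] =
      (conj x * y * ∫ t, φ i t * conj (φ j t) ∂F).re / 2 := by
  have := h.gaussian.isProbabilityMeasure
  have hint := fun i => (h.memLp_two i).integrable one_le_two
  have hmean : ∀ i (x : ℂ), ∫ ω, inner ℝ x (Z i ω) ∂P = 0 := by
    intro i x
    rw [integral_inner (hint i), h.centered, inner_zero_right]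
  rw [covariance_eq_sub ((h.memLp_two i).const_inner x) ((h.memLp_two j).const_inner y), hmean,
    hmean, mul_zero, sub_zero, ← h.cov]
  have hm : Integrable (fun ω => Z i ω * Z j ω) P := (h.memLp_two i).integrable_mul (h.memLp_two j)
  have hc : Integrable (fun ω => Z i ω * conj (Z j ω)) P :=
    (h.memLp_two i).integrable_mul (memLp_conj (h.memLp_two j))
  have hre : ∀ ω, inner ℝ x (Z i ω) * inner ℝ y (Z j ω) =
      ((conj x * y * (Z i ω * conj (Z j ω)) + conj x * conj y * (Z i ω * Z j ω)) / 2 : ℂ).re := by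
    intro ω
    simp only [Complex.inner]
    simp
    ring
  simp only [Pi.mul_apply, hre]
  have e := integral_re (𝕜 := ℂ) (((hc.const_mul (conj x * y)).add
    (hm.const_mul (conj x * conj y))).div_const 2)
  simp only [RCLike.re_to_complex, Pi.add_apply] at e
  rw [e, integral_div, integral_add (hc.const_mul _) (hm.const_mul _), integral_const_mul,
    integral_const_mul, h.circular]
  simp

theorem indepFun_of_orthogonal {T₁ T₂ : Type*} {Z₁ : T₁ → Ω → ℂ} {Z₂ : T₂ → Ω → ℂ}
    {φ₁ : T₁ → S → ℂ} {φ₂ : T₂ → S → ℂ}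
    (h : IsSpectral P F (Sum.elim Z₁ Z₂) (Sum.elim φ₁ φ₂))
    (h0 : ∀ i j, ∫ t, φ₁ i t * conj (φ₂ j t) ∂F = 0) :
    IndepFun (fun ω i => Z₁ i ω) (fun ω j => Z₂ j ω) P := by
  refine h.gaussian.indepFun_of_covariance_inner (fun i => h.gaussian.aemeasurable (Sum.inl i))
    (fun j => h.gaussian.aemeasurable (Sum.inr j)) fun i j x y => ?_
  have := h.covariance_inner (Sum.inl i) (Sum.inr j) x y
  simpa [h0] using this

theorem indepFun_pair (h : IsSpectral P F Z φ) (i j : T)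
    (h0 : ∫ t, φ i t * conj (φ j t) ∂F = 0) : IndepFun (Z i) (Z j) P := by
  refine h.gaussian.hasGaussianLaw_prodMk.indepFun_of_covariance_inner fun x y => ?_
  rw [h.covariance_inner, h0]
  simp

end IsSpectral

/-! ### The Gaussian density and exponentially weighted moments. -/

namespace IsSpectral

variable {Ω S T : Type*} [MeasurableSpace Ω] [MeasurableSpace S] {P : Measure Ω}
  {F : Measure S} {Z : T → Ω → ℂ} {φ : T → S → ℂ}

/-- Real and imaginary parts are uncorrelated, hence independent, each of variance a/2. -/
theorem map_eq_withDensity (h : IsSpectral P F Z φ) (i : T) {a : ℝ} (ha : 0 < a)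
    (hφ : ∫ t, ‖φ i t‖ ^ 2 ∂F = a) :
    P.map (Z i) = (volume : Measure ℂ).withDensity fun w =>
      ENNReal.ofReal (1 / (Real.pi * a) * Real.exp (-‖w‖ ^ 2 / a)) := by
  have := h.gaussian.isProbabilityMeasure
  have hZ := h.gaussian.hasGaussianLaw_eval i
  have hcov : ∫ t, φ i t * conj (φ i t) ∂F = a := by
    simp only [Complex.mul_conj, Complex.normSq_eq_norm_sq]
    rw [integral_complex_ofReal, hφ]
  have hpair : HasGaussianLaw (fun ω => ((Z i ω).re, (Z i ω).im)) P :=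
    hZ.map_equiv Complex.equivRealProdCLM
  have hre : (fun ω => inner ℝ 1 (Z i ω)) = fun ω => (Z i ω).re := by
    ext ω; simp [Complex.inner]
  have him : (fun ω => inner ℝ Complex.I (Z i ω)) = fun ω => (Z i ω).im := by
    ext ω; simp [Complex.inner]
  have hmean : ∀ x : ℂ, ∫ ω, inner ℝ x (Z i ω) ∂P = 0 := by
    intro x
    rw [integral_inner hZ.integrable, h.centered, inner_zero_right]
  have h1 := h.covariance_inner i i 1 Complex.I
  have h2 := h.covariance_inner i i 1 1
  have h3 := h.covariance_inner i i Complex.I Complex.I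
  have m1 := hmean 1
  have m2 := hmean Complex.I
  rw [hre] at h1 h2 m1
  rw [him] at h1 h3 m2
  rw [hcov] at h1 h2 h3
  simp at h1 h2 h3
  have hind := hpair.indepFun_of_covariance_eq_zero h1
  have l1 := hpair.fst.map_eq_gaussianReal
  have l2 := hpair.snd.map_eq_gaussianReal
  rw [m1, ← covariance_self hpair.fst.aemeasurable, h2] at l1
  rw [m2, ← covariance_self hpair.snd.aemeasurable, h3] at l2
  have hv : (a / 2).toNNReal ≠ 0 := by simpa using ha
  rw [gaussianReal_of_var_ne_zero _ hv] at l1 l2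
  have hprod := (indepFun_iff_map_prod_eq_prod_map_map hpair.fst.aemeasurable
    hpair.snd.aemeasurable).1 hind
  rw [l1, l2, prod_withDensity (measurable_gaussianPDF _ _) (measurable_gaussianPDF _ _),
    ← Measure.volume_eq_prod] at hprod
  have hmap : P.map (Z i) = (P.map fun ω => ((Z i ω).re, (Z i ω).im)).map
      Complex.measurableEquivRealProd.symm := by
    rw [AEMeasurable.map_map_of_aemeasurable
      Complex.measurableEquivRealProd.symm.measurable.aemeasurable hpair.aemeasurable]
    rfl
  rw [hmap, hprod]
  ext s hs
  rw [Complex.measurableEquivRealProd.symm.map_apply, withDensity_apply _ hs, withDensity_apply _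
    (Complex.measurableEquivRealProd.symm.measurable hs),
    ← (Complex.volume_preserving_equiv_real_prod.symm).setLIntegral_comp_preimage_emb
      Complex.measurableEquivRealProd.symm.measurableEmbedding]
  refine lintegral_congr fun p => ?_
  rw [gaussianPDF, gaussianPDF, ← ENNReal.ofReal_mul (gaussianPDFReal_nonneg _ _ _)]
  congr 1
  simp only [gaussianPDFReal, Real.coe_toNNReal _ (half_pos ha).le, sub_zero]
  rw [mul_mul_mul_comm, ← Real.exp_add, ← mul_inv, Real.mul_self_sqrt (by positivity),
    ← Complex.normSq_eq_norm_sq, Complex.normSq_apply, one_div]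
  have e1 : (Complex.measurableEquivRealProd.symm p).re = p.1 := rfl
  have e2 : (Complex.measurableEquivRealProd.symm p).im = p.2 := rfl
  rw [e1, e2]
  congr 2
  · ring
  · field_simp
    ring

theorem integral_comp_eq (h : IsSpectral P F Z φ) (i : T) {a : ℝ} (ha : 0 < a)
    (hφ : ∫ t, ‖φ i t‖ ^ 2 ∂F = a) {g : ℂ → ℝ} (hg : Measurable g) :
    ∫ ω, g (Z i ω) ∂P = ∫ w, 1 / (Real.pi * a) * Real.exp (-‖w‖ ^ 2 / a) * g w := by
  rw [← integral_map (f := g) (h.gaussian.aemeasurable i) hg.aestronglyMeasurable,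
    h.map_eq_withDensity i ha hφ, integral_withDensity_eq_integral_toReal_smul (by fun_prop)
      (.of_forall fun _ => ENNReal.ofReal_lt_top)]
  refine integral_congr_ae (.of_forall fun w => ?_)
  simp only [smul_eq_mul]
  rw [ENNReal.toReal_ofReal (by positivity)]

theorem ae_eq_zero (h : IsSpectral P F Z φ) (i : T) (hφ : ∫ t, ‖φ i t‖ ^ 2 ∂F = 0) :
    Z i =ᵐ[P] 0 := by
  rw [← h.integral_norm_sq, integral_eq_zero_iff_of_nonneg (fun ω => by positivity)
    ((h.memLp_two i).integrable_norm_pow two_ne_zero)] at hφ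
  filter_upwards [hφ] with ω hω
  simpa using hω

theorem integral_exp_neg_norm_sq (h : IsSpectral P F Z φ) (i : T) {a : ℝ}
    (hφ : ∫ t, ‖φ i t‖ ^ 2 ∂F = a) : ∫ ω, Real.exp (-‖Z i ω‖ ^ 2) ∂P = 1 / (1 + a) := by
  have := h.gaussian.isProbabilityMeasure
  have ha0 : 0 ≤ a := hφ ▸ integral_nonneg fun t => by positivity
  rcases ha0.eq_or_lt with rfl | ha
  · rw [integral_congr_ae (g := fun _ => 1)]
    · simp
    · filter_upwards [h.ae_eq_zero i hφ] with ω hω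
      simp [hω]
  · rw [h.integral_comp_eq i ha hφ (g := fun w => Real.exp (-‖w‖ ^ 2)) (by fun_prop)]
    have e := Complex.integral_rpow_mul_exp_neg_mul_rpow (p := 2) (q := 0) (b := 1 + 1 / a)
      one_le_two (by norm_num) (by positivity)
    have : ∀ w : ℂ, 1 / (Real.pi * a) * Real.exp (-‖w‖ ^ 2 / a) * Real.exp (-‖w‖ ^ 2) =
        1 / (Real.pi * a) * (‖w‖ ^ (0 : ℝ) * Real.exp (-(1 + 1 / a) * ‖w‖ ^ (2 : ℝ))) := by
      intro w
      rw [mul_assoc, ← Real.exp_add, Real.rpow_zero, one_mul, Real.rpow_two]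
      congr 2
      ring
    simp_rw [this]
    rw [integral_const_mul, e]
    norm_num [Real.rpow_neg_one]
    field_simp
    ring

theorem integral_norm_sq_mul_exp_neg_norm_sq (h : IsSpectral P F Z φ) (i : T) {a : ℝ}
    (hφ : ∫ t, ‖φ i t‖ ^ 2 ∂F = a) :
    ∫ ω, ‖Z i ω‖ ^ 2 * Real.exp (-‖Z i ω‖ ^ 2) ∂P = a / (1 + a) ^ 2 := by
  have := h.gaussian.isProbabilityMeasure
  have ha0 : 0 ≤ a := hφ ▸ integral_nonneg fun t => by positivity
  rcases ha0.eq_or_lt with rfl | ha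
  · rw [integral_congr_ae (g := fun _ => 0)]
    · simp
    · filter_upwards [h.ae_eq_zero i hφ] with ω hω
      simp [hω]
  · rw [h.integral_comp_eq i ha hφ (g := fun w => ‖w‖ ^ 2 * Real.exp (-‖w‖ ^ 2)) (by fun_prop)]
    have e := Complex.integral_rpow_mul_exp_neg_mul_rpow (p := 2) (q := 2) (b := 1 + 1 / a)
      one_le_two (by norm_num) (by positivity)
    have : ∀ w : ℂ, 1 / (Real.pi * a) * Real.exp (-‖w‖ ^ 2 / a) *
        (‖w‖ ^ 2 * Real.exp (-‖w‖ ^ 2)) =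
        1 / (Real.pi * a) * (‖w‖ ^ (2 : ℝ) * Real.exp (-(1 + 1 / a) * ‖w‖ ^ (2 : ℝ))) := by
      intro w
      rw [Real.rpow_two, mul_assoc, mul_left_comm (Real.exp _), ← Real.exp_add]
      congr 3
      ring
    simp_rw [this]
    rw [integral_const_mul, e]
    have h2 : (2 + 2 : ℝ) / 2 = (1 : ℕ) + 1 := by norm_num
    have h3 : -(2 + 2 : ℝ) / 2 = -((2 : ℕ) : ℝ) := by norm_num
    rw [h2, h3, Real.Gamma_nat_eq_factorial, Real.rpow_neg (by positivity), Real.rpow_natCast]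
    simp only [Nat.factorial_one, Nat.cast_one]
    field_simp
    ring

theorem integrable_norm_sq_mul_exp (h : IsSpectral P F Z φ) (i j : T) :
    Integrable (fun ω => ‖Z j ω‖ ^ 2 * Real.exp (-‖Z i ω‖ ^ 2)) P := by
  have hi := h.gaussian.aemeasurable i
  refine ((h.memLp_two j).integrable_norm_pow two_ne_zero).mul_of_top_left ?_
  refine memLp_top_of_bound (by fun_prop) 1 (.of_forall fun ω => ?_)
  rw [Real.norm_eq_abs, Real.abs_exp, Real.exp_le_one_iff]
  simp

theorem integral_norm_sq_mul_exp_of_orthogonal (h : IsSpectral P F Z φ) (i j : T)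
    (h0 : ∫ t, φ j t * conj (φ i t) ∂F = 0) :
    ∫ ω, ‖Z j ω‖ ^ 2 * Real.exp (-‖Z i ω‖ ^ 2) ∂P =
      (∫ t, ‖φ j t‖ ^ 2 ∂F) / (1 + ∫ t, ‖φ i t‖ ^ 2 ∂F) := by
  have hind := (h.indepFun_pair j i h0).comp (φ := fun w : ℂ => ‖w‖ ^ 2)
    (ψ := fun w : ℂ => Real.exp (-‖w‖ ^ 2)) (by fun_prop) (by fun_prop)
  have hi := h.gaussian.aemeasurable i
  have hj := h.gaussian.aemeasurable j
  have := hind.integral_fun_mul_eq_mul_integral (by fun_prop) (by fun_prop)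
  simp only [Function.comp_apply] at this
  rw [this, h.integral_norm_sq, h.integral_exp_neg_norm_sq i rfl]
  ring

theorem integral_mul_conj_mul_exp_of_orthogonal (h : IsSpectral P F Z φ) (i j : T)
    (h0 : ∫ t, φ j t * conj (φ i t) ∂F = 0) :
    ∫ ω, Z j ω * (conj (Z i ω) * Real.exp (-‖Z i ω‖ ^ 2)) ∂P = 0 := by
  have hind := (h.indepFun_pair j i h0).comp (φ := fun w : ℂ => w)
    (ψ := fun w : ℂ => conj w * Real.exp (-‖w‖ ^ 2)) (by fun_prop) (by fun_prop)
  have hi := h.gaussian.aemeasurable i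
  have hj := h.gaussian.aemeasurable j
  have := hind.integral_fun_mul_eq_mul_integral (by fun_prop)
    (by exact (Measurable.comp_aemeasurable (g := fun w : ℂ => conj w * Real.exp (-‖w‖ ^ 2))
      (by fun_prop) hi).aestronglyMeasurable)
  simp only [Function.comp_apply] at this
  rw [this, h.centered, zero_mul]

/-- Gaussian regression: `Z j` is l · `Z i` plus a residual orthogonal to `Z i`, hence independent
of it. The cross term then has mean zero, and the two squares follow from the one-variable
integrals. In the degenerate case a = 0 the variable `Z i` vanishes almost surely. -/
theorem integral_norm_sq_mul_exp (h : IsSpectral P F Z φ) (i j : T) :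
    ∫ ω, ‖Z j ω‖ ^ 2 * Real.exp (-‖Z i ω‖ ^ 2) ∂P =
      (∫ t, ‖φ j t‖ ^ 2 ∂F) / (1 + ∫ t, ‖φ i t‖ ^ 2 ∂F) -
        ‖∫ t, φ j t * conj (φ i t) ∂F‖ ^ 2 / (1 + ∫ t, ‖φ i t‖ ^ 2 ∂F) ^ 2 := by
  have hP := h.gaussian.isProbabilityMeasure
  set a := ∫ t, ‖φ i t‖ ^ 2 ∂F with ha
  set b := ∫ t, φ j t * conj (φ i t) ∂F with hb
  have ha0 : 0 ≤ a := integral_nonneg fun t => by positivity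
  rcases ha0.eq_or_lt with ha' | ha'
  · have hZ := h.ae_eq_zero i (ha'.symm ▸ ha.symm)
    have hb0 : b = 0 := by
      rw [hb, ← h.cov, integral_congr_ae (g := fun _ => 0)]
      · simp
      · filter_upwards [hZ] with ω hω
        simp [hω]
    rw [h.integral_norm_sq_mul_exp_of_orthogonal i j hb0, ← ha, hb0]
    simp
  · set l : ℂ := b / a with hl
    -- Index `true` is the residual, index `false` is `Z i` itself.
    let h' := h.lin_comb (T' := Bool) (fun _ => 1) (fun k => if k then -l else 0)
      (fun k => if k then j else i) (fun _ => i)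
    have hφi : ∫ t, φ i t * conj (φ i t) ∂F = a := by
      simp only [Complex.mul_conj, Complex.normSq_eq_norm_sq]
      rw [integral_complex_ofReal, ha]
    have hφj : ∫ t, φ j t * conj (φ j t) ∂F = (∫ t, ‖φ j t‖ ^ 2 ∂F : ℝ) := by
      simp only [Complex.mul_conj, Complex.normSq_eq_norm_sq]
      rw [integral_complex_ofReal]
    have hφij : ∫ t, φ i t * conj (φ j t) ∂F = conj b := by
      rw [hb, ← integral_conj]
      simp [mul_comm]
    have ha'' : (a : ℂ) ≠ 0 := by exact_mod_cast ha'.ne'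
    have horth : ∫ t, (1 * φ j t + -l * φ i t) * conj (1 * φ i t + 0 * φ i t) ∂F = 0 := by
      rw [integral_lin_comb_mul_conj (h.memLp _) (h.memLp _) (h.memLp _) (h.memLp _), hφi, ← hb, hl]
      field_simp
      simp
    have hV : ∫ t, ‖1 * φ j t + -l * φ i t‖ ^ 2 ∂F = (∫ t, ‖φ j t‖ ^ 2 ∂F) - ‖b‖ ^ 2 / a := by
      have e := integral_lin_comb_mul_conj (h.memLp j) (h.memLp i) (h.memLp j) (h.memLp i)
        1 (-l) 1 (-l)
      rw [hφi, ← hb, hφj, hφij] at e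
      simp only [Complex.mul_conj, Complex.normSq_eq_norm_sq] at e
      rw [integral_complex_ofReal] at e
      have e2 : ((∫ t, ‖1 * φ j t + -l * φ i t‖ ^ 2 ∂F : ℝ) : ℂ) =
          (((∫ t, ‖φ j t‖ ^ 2 ∂F) - ‖b‖ ^ 2 / a : ℝ) : ℂ) := by
        rw [e]
        push_cast
        simp_rw [← Complex.mul_conj']
        rw [hl]
        simp only [map_neg, map_div₀, Complex.conj_ofReal, map_one]
        field_simp
        ring
      exact_mod_cast e2
    have e1 := h'.integral_norm_sq_mul_exp_of_orthogonal false true (by simpa using horth)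
    have e2 := h'.integral_mul_conj_mul_exp_of_orthogonal false true (by simpa using horth)
    have i1 := h'.integrable_norm_sq_mul_exp false true
    simp only [if_true, Bool.false_eq_true, if_false, zero_mul, add_zero, one_mul] at e1 e2 i1
    simp only [one_mul] at hV
    rw [hV, ← ha] at e1
    have i2 := h.integrable_norm_sq_mul_exp i i
    have i3 : Integrable (fun ω => (Z j ω + -l * Z i ω) *
        (conj (Z i ω) * Real.exp (-‖Z i ω‖ ^ 2))) P := by
      have hi := h.gaussian.aemeasurable i
      have hj := h.gaussian.aemeasurable j
      have hm := (h'.memLp_two true).integrable_mul (memLp_conj (h.memLp_two i))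
      have : Integrable (fun ω => (Z j ω + -l * Z i ω) * conj (Z i ω) *
          (Real.exp (-‖Z i ω‖ ^ 2) : ℂ)) P := by
        refine Integrable.mul_of_top_left (by simpa [Pi.mul_def] using hm) ?_
        refine memLp_top_of_bound (Measurable.comp_aemeasurable
          (g := fun w : ℂ => (Real.exp (-‖w‖ ^ 2) : ℂ)) (by fun_prop) hi).aestronglyMeasurable 1
          (.of_forall fun ω => ?_)
        rw [Complex.norm_real, Real.norm_eq_abs, Real.abs_exp, Real.exp_le_one_iff]
        simp
      simpa only [mul_assoc] using this
    have hsplit : ∀ ω, ‖Z j ω‖ ^ 2 * Real.exp (-‖Z i ω‖ ^ 2) =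
        ‖Z j ω + -l * Z i ω‖ ^ 2 * Real.exp (-‖Z i ω‖ ^ 2) +
        ‖l‖ ^ 2 * (‖Z i ω‖ ^ 2 * Real.exp (-‖Z i ω‖ ^ 2)) +
        (2 * conj l * ((Z j ω + -l * Z i ω) * (conj (Z i ω) * Real.exp (-‖Z i ω‖ ^ 2)))).re := by
      intro ω
      generalize Real.exp (-‖Z i ω‖ ^ 2) = x
      simp only [← Complex.normSq_eq_norm_sq, Complex.normSq_apply]
      simp
      ring
    have i4 := i3.const_mul (2 * conj l)
    have i4' := i4.re
    have e4 := integral_re (𝕜 := ℂ) i4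
    simp only [RCLike.re_to_complex] at e4 i4'
    simp_rw [hsplit]
    rw [integral_add (by fun_prop) i4', integral_add i1 (i2.const_mul _), e1,
      integral_const_mul, h.integral_norm_sq_mul_exp_neg_norm_sq i ha.symm, e4,
      integral_const_mul, e2, hl]
    simp only [norm_div, Complex.norm_real, Real.norm_eq_abs, abs_of_pos ha', mul_zero,
      Complex.zero_re, add_zero]
    field_simp
    ring

end IsSpectral

/-! ### Passing weighted moments to almost sure limits. -/

theorem eLpNorm_two_eq {α : Type*} [MeasurableSpace α] (μ : Measure α) (f : α → ℂ) :
    eLpNorm f 2 μ = (∫⁻ x, ENNReal.ofReal (‖f x‖ ^ 2) ∂μ) ^ (1 / 2 : ℝ) := by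
  rw [eLpNorm_eq_lintegral_rpow_enorm_toReal two_ne_zero ENNReal.ofNat_ne_top]
  simp [ENNReal.ofReal_pow]

theorem lintegral_norm_sq_eq_of_tendsto {α : Type*} [MeasurableSpace α] {μ : Measure α}
    {f : ℕ → α → ℂ} {g : α → ℂ} {x : ℝ≥0∞} (hf : ∀ n, AEStronglyMeasurable (f n) μ)
    (hg : AEStronglyMeasurable g μ)
    (hx : Filter.Tendsto (fun n => ∫⁻ a, ENNReal.ofReal (‖f n a‖ ^ 2) ∂μ) Filter.atTop (nhds x))
    (h0 : Filter.Tendsto (fun n => ∫⁻ a, ENNReal.ofReal (‖g a - f n a‖ ^ 2) ∂μ) Filter.atTop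
      (nhds 0)) :
    ∫⁻ a, ENNReal.ofReal (‖g a‖ ^ 2) ∂μ = x := by
  have hx' : Filter.Tendsto (fun n => eLpNorm (f n) 2 μ) Filter.atTop (nhds (x ^ (1 / 2 : ℝ))) := by
    simp_rw [eLpNorm_two_eq]
    exact (ENNReal.continuous_rpow_const.tendsto _).comp hx
  have h0' : Filter.Tendsto (fun n => eLpNorm (g - f n) 2 μ) Filter.atTop (nhds 0) := by
    simp_rw [eLpNorm_two_eq]
    have := (ENNReal.continuous_rpow_const (y := (1 / 2 : ℝ))).tendsto 0
    rw [ENNReal.zero_rpow_of_pos (by norm_num)] at this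
    exact this.comp h0
  have h1 : eLpNorm g 2 μ ≤ x ^ (1 / 2 : ℝ) := by
    have := h0'.add hx'
    rw [zero_add] at this
    refine ge_of_tendsto' this fun n => ?_
    simpa using eLpNorm_add_le (hg.sub (hf n)) (hf n) one_le_two
  have h2 : x ^ (1 / 2 : ℝ) ≤ eLpNorm g 2 μ := by
    have := (tendsto_const_nhds (x := eLpNorm g 2 μ)).add h0'
    rw [add_zero] at this
    refine le_of_tendsto_of_tendsto' hx' this fun n => ?_
    simpa using eLpNorm_sub_le hg (hg.sub (hf n)) one_le_two
  have h3 := h1.antisymm h2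
  rw [eLpNorm_two_eq] at h3
  exact (ENNReal.rpow_left_injective (by norm_num : (1 / 2 : ℝ) ≠ 0)) h3

namespace IsSpectral

variable {Ω S T : Type*} [MeasurableSpace Ω] [MeasurableSpace S] {P : Measure Ω}
  {F : Measure S} {Z : T → Ω → ℂ} {φ : T → S → ℂ}

/-- Distances between members of the family are computed in L²(F), where bounded convergence
applies; Fatou's lemma then bounds the distance to the almost sure limit. So almost sure convergence
here is also L² convergence. -/
theorem lintegral_norm_sub_sq_le_of_tendsto [IsFiniteMeasure F] (h : IsSpectral P F Z φ)
    (j : ℕ → T) {Y : Ω → ℂ} {ψ : S → ℂ} {M : ℝ} (hM : ∀ n t, ‖φ (j n) t‖ ≤ M)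
    (hφ : ∀ t, Filter.Tendsto (fun n => φ (j n) t) Filter.atTop (nhds (ψ t)))
    (hY : ∀ᵐ ω ∂P, Filter.Tendsto (fun n => Z (j n) ω) Filter.atTop (nhds (Y ω))) (n : ℕ) :
    ∫⁻ ω, ENNReal.ofReal (‖Y ω - Z (j n) ω‖ ^ 2) ∂P ≤
      ENNReal.ofReal (∫ t, ‖ψ t - φ (j n) t‖ ^ 2 ∂F) := by
  have hZm := fun m => h.gaussian.aemeasurable (j m)
  have hφm := fun m => (h.memLp (j m)).1.aemeasurable
  have hd : ∀ m, ∫⁻ ω, ENNReal.ofReal (‖Z (j m) ω - Z (j n) ω‖ ^ 2) ∂P =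
      ENNReal.ofReal (∫ t, ‖φ (j m) t - φ (j n) t‖ ^ 2 ∂F) := by
    intro m
    have h' := h.lin_comb (T' := Unit) (fun _ => 1) (fun _ => -1) (fun _ => j m) (fun _ => j n)
    have e := h'.integral_norm_sq ()
    have i := (h'.memLp_two ()).integrable_norm_pow two_ne_zero
    simp only [one_mul, neg_one_mul, ← sub_eq_add_neg] at e i
    rw [← e, ofReal_integral_eq_lintegral_ofReal i (.of_forall fun _ => by positivity)]
  have hlim : Filter.Tendsto (fun m => ENNReal.ofReal (∫ t, ‖φ (j m) t - φ (j n) t‖ ^ 2 ∂F))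
      Filter.atTop (nhds (ENNReal.ofReal (∫ t, ‖ψ t - φ (j n) t‖ ^ 2 ∂F))) := by
    refine ENNReal.tendsto_ofReal (tendsto_integral_of_dominated_convergence
      (fun _ => (M + M) ^ 2) (fun m => by fun_prop) (integrable_const _)
      (fun m => .of_forall fun t => ?_) (.of_forall fun t => ?_))
    · rw [norm_pow, norm_norm]
      gcongr
      exact (norm_sub_le _ _).trans (add_le_add (hM m t) (hM n t))
    · exact (((hφ t).sub_const _).norm).pow 2
  calc ∫⁻ ω, ENNReal.ofReal (‖Y ω - Z (j n) ω‖ ^ 2) ∂P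
      = ∫⁻ ω, Filter.liminf (fun m => ENNReal.ofReal (‖Z (j m) ω - Z (j n) ω‖ ^ 2))
          Filter.atTop ∂P := by
        refine lintegral_congr_ae ?_
        filter_upwards [hY] with ω hω
        exact ((ENNReal.tendsto_ofReal (((hω.sub_const _).norm).pow 2)).liminf_eq).symm
    _ ≤ Filter.liminf (fun m => ∫⁻ ω, ENNReal.ofReal (‖Z (j m) ω - Z (j n) ω‖ ^ 2) ∂P)
          Filter.atTop := lintegral_liminf_le' fun m => by fun_prop
    _ = _ := by
        simp_rw [hd]
        exact hlim.liminf_eq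

/-- The moment formula extends to a limit Y by continuity of both sides, without showing that Y is
Gaussian. -/
theorem lintegral_norm_sq_mul_exp_of_tendsto [IsFiniteMeasure F] (h : IsSpectral P F Z φ) (i : T)
    (j : ℕ → T) {Y : Ω → ℂ} {ψ : S → ℂ} {M : ℝ} (hM : ∀ n t, ‖φ (j n) t‖ ≤ M)
    (hφ : ∀ t, Filter.Tendsto (fun n => φ (j n) t) Filter.atTop (nhds (ψ t)))
    (hY : ∀ᵐ ω ∂P, Filter.Tendsto (fun n => Z (j n) ω) Filter.atTop (nhds (Y ω))) :
    ∫⁻ ω, ENNReal.ofReal (‖Y ω‖ ^ 2 * Real.exp (-‖Z i ω‖ ^ 2)) ∂P =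
      ENNReal.ofReal ((∫ t, ‖ψ t‖ ^ 2 ∂F) / (1 + ∫ t, ‖φ i t‖ ^ 2 ∂F) -
        ‖∫ t, ψ t * conj (φ i t) ∂F‖ ^ 2 / (1 + ∫ t, ‖φ i t‖ ^ 2 ∂F) ^ 2) := by
  have hZm := fun m => h.gaussian.aemeasurable (j m)
  have hφm := fun m => (h.memLp (j m)).1.aemeasurable
  have hψm : AEMeasurable ψ F := aemeasurable_of_tendsto_metrizable_ae _ hφm (.of_forall hφ)
  have hZi := h.gaussian.aemeasurable i
  have hYm : AEMeasurable Y P := aemeasurable_of_tendsto_metrizable_ae _ hZm hY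
  have hψM : ∀ t, ‖ψ t‖ ≤ M := fun t => le_of_tendsto' (hφ t).norm fun n => hM n t
  -- The square root of the weight, so that the weighted moment becomes an L² norm. As |w| ≤ 1, L²
  -- convergence survives multiplication by it.
  let w : Ω → ℂ := fun ω => (Real.exp (-‖Z i ω‖ ^ 2 / 2) : ℂ)
  have hwm : AEMeasurable w P := by
    exact Measurable.comp_aemeasurable (g := fun z : ℂ => (Real.exp (-‖z‖ ^ 2 / 2) : ℂ))
      (by fun_prop) hZi
  have hw : ∀ (u : ℂ) ω, ‖u * w ω‖ ^ 2 = ‖u‖ ^ 2 * Real.exp (-‖Z i ω‖ ^ 2) := by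
    intro u ω
    rw [norm_mul, mul_pow, Complex.norm_real, Real.norm_eq_abs, Real.abs_exp, ← Real.exp_nat_mul]
    congr 2
    push_cast
    ring
  have key := lintegral_norm_sq_eq_of_tendsto (μ := P) (f := fun n ω => Z (j n) ω * w ω)
    (g := fun ω => Y ω * w ω) (x := ENNReal.ofReal ((∫ t, ‖ψ t‖ ^ 2 ∂F) /
      (1 + ∫ t, ‖φ i t‖ ^ 2 ∂F) - ‖∫ t, ψ t * conj (φ i t) ∂F‖ ^ 2 /
        (1 + ∫ t, ‖φ i t‖ ^ 2 ∂F) ^ 2))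
    (fun n => ((hZm n).mul hwm).aestronglyMeasurable) (hYm.mul hwm).aestronglyMeasurable ?_ ?_
  · simpa only [hw] using key
  · simp_rw [hw]
    have : ∀ n, ∫⁻ ω, ENNReal.ofReal (‖Z (j n) ω‖ ^ 2 * Real.exp (-‖Z i ω‖ ^ 2)) ∂P =
        ENNReal.ofReal ((∫ t, ‖φ (j n) t‖ ^ 2 ∂F) / (1 + ∫ t, ‖φ i t‖ ^ 2 ∂F) -
        ‖∫ t, φ (j n) t * conj (φ i t) ∂F‖ ^ 2 / (1 + ∫ t, ‖φ i t‖ ^ 2 ∂F) ^ 2) := by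
      intro n
      rw [← h.integral_norm_sq_mul_exp, ofReal_integral_eq_lintegral_ofReal
        (h.integrable_norm_sq_mul_exp i (j n)) (.of_forall fun _ => by positivity)]
    simp_rw [this]
    have l1 : Filter.Tendsto (fun n => ∫ t, ‖φ (j n) t‖ ^ 2 ∂F) Filter.atTop
        (nhds (∫ t, ‖ψ t‖ ^ 2 ∂F)) := by
      refine tendsto_integral_of_dominated_convergence (fun _ => M ^ 2) (fun m => by fun_prop)
        (integrable_const _) (fun m => .of_forall fun t => ?_)
        (.of_forall fun t => ((hφ t).norm).pow 2)
      rw [norm_pow, norm_norm]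
      gcongr
      exact hM m t
    have l2 : Filter.Tendsto (fun n => ∫ t, φ (j n) t * conj (φ i t) ∂F) Filter.atTop
        (nhds (∫ t, ψ t * conj (φ i t) ∂F)) := by
      have hφi := (h.memLp i).1.aemeasurable
      refine tendsto_integral_of_dominated_convergence (fun t => M * ‖φ i t‖)
        (fun m => ((hφm m).mul (memLp_conj (h.memLp i)).1.aemeasurable).aestronglyMeasurable)
        ((((h.memLp i).integrable one_le_two).norm).const_mul M) (fun m => .of_forall fun t => ?_)
        (.of_forall fun t => (hφ t).mul_const _)
      rw [norm_mul, RCLike.norm_conj]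
      gcongr
      exact hM m t
    exact ENNReal.tendsto_ofReal ((l1.div_const _).sub ((l2.norm.pow 2).div_const _))
  · have hle : ∀ n, ∫⁻ ω, ENNReal.ofReal (‖Y ω * w ω - Z (j n) ω * w ω‖ ^ 2) ∂P ≤
        ENNReal.ofReal (∫ t, ‖ψ t - φ (j n) t‖ ^ 2 ∂F) := by
      intro n
      refine le_trans (lintegral_mono fun ω => ?_)
        (h.lintegral_norm_sub_sq_le_of_tendsto j hM hφ hY n)
      rw [← sub_mul, hw]
      refine ENNReal.ofReal_le_ofReal (mul_le_of_le_one_right (by positivity) ?_)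
      rw [Real.exp_le_one_iff]
      simp
    refine tendsto_of_tendsto_of_tendsto_of_le_of_le tendsto_const_nhds ?_ (fun _ => zero_le) hle
    rw [← ENNReal.ofReal_zero]
    refine ENNReal.tendsto_ofReal ?_
    have := tendsto_integral_of_dominated_convergence (μ := F)
      (F := fun n t => ‖ψ t - φ (j n) t‖ ^ 2) (f := fun _ => 0)
      (fun _ => (M + M) ^ 2) (fun m => by fun_prop) (integrable_const _)
      (fun m => .of_forall fun t => ?_) (.of_forall fun t => ?_)
    · simpa using this
    · rw [norm_pow, norm_norm]
      gcongr
      exact (norm_sub_le _ _).trans (add_le_add (hψM t) (hM m t))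
    · simpa using ((((hφ t).const_sub (ψ t)).norm).pow 2)

end IsSpectral

/-! ### The Szegő kernel -/

theorem norm_expNeg (t : Torus) : ‖expNeg t‖ = 1 := by
  rw [expNeg, Complex.norm_exp]
  simp

@[fun_prop]
theorem measurable_expNeg : Measurable expNeg := by
  unfold expNeg
  fun_prop

@[fun_prop]
theorem measurable_szego (z : ℂ) : Measurable (szego z) := by
  unfold szego
  fun_prop

theorem one_sub_norm_le_norm_one_sub (z : ℂ) (t : Torus) : 1 - ‖z‖ ≤ ‖1 - z * expNeg t‖ := by
  have := norm_sub_norm_le (1 : ℂ) (z * expNeg t)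
  rwa [norm_mul, norm_expNeg, mul_one, norm_one] at this

theorem one_sub_mul_expNeg_ne_zero {z : ℂ} (hz : z ∈ disk) (t : Torus) : 1 - z * expNeg t ≠ 0 := by
  rw [mem_ball_zero_iff] at hz
  exact norm_pos_iff.1 ((sub_pos.2 hz).trans_le (one_sub_norm_le_norm_one_sub z t))

theorem norm_szego_le {z : ℂ} {r : ℝ} (hz : ‖z‖ ≤ r) (hr : r < 1) (t : Torus) :
    ‖szego z t‖ ≤ 1 / (1 - r) := by
  rw [szego, norm_div, norm_one]
  exact one_div_le_one_div_of_le (sub_pos.2 hr)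
    ((sub_le_sub_left hz 1).trans (one_sub_norm_le_norm_one_sub z t))

theorem szego_zero (t : Torus) : szego 0 t = 1 := by simp [szego]

/-- Inversion carries the disk |u - 1| ≤ 1 without 0 into the half-plane Re ≥ 1/2. This is what
keeps the mean K(z,0) away from 0 and K(z,z) positive. -/
theorem half_le_re_szego {z : ℂ} (hz : z ∈ disk) (t : Torus) : 1 / 2 ≤ (szego z t).re := by
  have h0 := Complex.normSq_pos.2 (one_sub_mul_expNeg_ne_zero hz t)
  rw [szego, one_div (1 - _), Complex.inv_re, le_div_iff₀ h0]
  have h1 : Complex.normSq (z * expNeg t) ≤ 1 := by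
    rw [Complex.normSq_eq_norm_sq, norm_mul, norm_expNeg, mul_one]
    rw [mem_ball_zero_iff] at hz
    exact pow_le_one₀ (norm_nonneg z) hz.le
  rw [Complex.normSq_apply] at h1 ⊢
  simp only [Complex.sub_re, Complex.sub_im, Complex.one_re, Complex.one_im]
  nlinarith

theorem hasDerivAt_szego {z : ℂ} (hz : z ∈ disk) (t : Torus) :
    HasDerivAt (fun z => szego z t) (expNeg t * szego z t ^ 2) z := by
  have h0 := one_sub_mul_expNeg_ne_zero hz t
  have h1 : HasDerivAt (fun z => 1 - z * expNeg t) (-expNeg t) z := by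
    simpa using ((hasDerivAt_id z).mul_const (expNeg t)).const_sub 1
  have h2 := h1.inv h0
  simp only [szego, one_div]
  convert! h2 using 1
  field_simp

theorem continuousOn_szego (t : Torus) : ContinuousOn (fun z => szego z t) disk := fun _ hz =>
  (hasDerivAt_szego hz t).continuousAt.continuousWithinAt

theorem memLp_szego (F : Measure Torus) [IsFiniteMeasure F] {z : ℂ} (hz : z ∈ disk) (p : ℝ≥0∞) :
    MemLp (szego z) p F := by
  rw [mem_ball_zero_iff] at hz
  exact MemLp.of_bound (measurable_szego z).aestronglyMeasurable _
    (.of_forall fun t => norm_szego_le le_rfl hz t)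

/-- The mean `∫ s(z,t) F(dt) = K(z,0)`. -/
def szegoMean (F : Measure Torus) (z : ℂ) : ℂ := ∫ t, szego z t ∂F

theorem half_le_norm_szegoMean (F : Measure Torus) [IsProbabilityMeasure F] {z : ℂ}
    (hz : z ∈ disk) : 1 / 2 ≤ ‖szegoMean F z‖ := by
  have hi : Integrable (szego z) F := (memLp_szego F hz 1).integrable le_rfl
  refine le_trans ?_ (Complex.re_le_norm _)
  have e := integral_re (𝕜 := ℂ) hi
  simp only [RCLike.re_to_complex] at e
  rw [szegoMean, ← e]
  have : ∫ _ : Torus, (1 / 2 : ℝ) ∂F ≤ ∫ t, (szego z t).re ∂F :=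
    integral_mono (integrable_const _) hi.re fun t => half_le_re_szego hz t
  simpa using this

theorem szegoMean_ne_zero (F : Measure Torus) [IsProbabilityMeasure F] {z : ℂ}
    (hz : z ∈ disk) : szegoMean F z ≠ 0 :=
  norm_pos_iff.1 (one_half_pos.trans_le (half_le_norm_szegoMean F hz))

theorem hasDerivAt_szegoMean (F : Measure Torus) [IsFiniteMeasure F] {z : ℂ} (hz : z ∈ disk) :
    HasDerivAt (szegoMean F) (∫ t, expNeg t * szego z t ^ 2 ∂F) z := by
  rw [mem_ball_zero_iff] at hz
  obtain ⟨r, hzr, hr⟩ := exists_between hz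
  have hmem : ∀ w ∈ Metric.ball (0 : ℂ) r, w ∈ disk := fun w hw =>
    Metric.ball_subset_ball hr.le hw
  refine (hasDerivAt_integral_of_dominated_loc_of_deriv_le (μ := F)
    (F := fun z t => szego z t) (F' := fun z t => expNeg t * szego z t ^ 2)
    (bound := fun _ => (1 / (1 - r)) ^ 2)
    (Metric.isOpen_ball.mem_nhds (mem_ball_zero_iff.2 hzr)) (.of_forall fun w => by fun_prop)
    ((memLp_szego F (mem_ball_zero_iff.2 hz) 1).integrable le_rfl) (by fun_prop)
    (.of_forall fun t w hw => ?_) (integrable_const _)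
    (.of_forall fun t w hw => hasDerivAt_szego (hmem w hw) t)).2
  rw [norm_mul, norm_expNeg, one_mul, norm_pow]
  gcongr
  exact norm_szego_le (mem_ball_zero_iff.1 hw).le hr t

theorem continuousOn_integral_of_forall_bound {α : Type*} [MeasurableSpace α] {μ : Measure α}
    [IsFiniteMeasure μ] {f : ℂ → α → ℝ} (hm : ∀ z, AEStronglyMeasurable (f z) μ)
    (hc : ∀ a, ContinuousOn (fun z => f z a) disk)
    (hb : ∀ r < 1, ∃ M, ∀ z a, ‖z‖ ≤ r → ‖f z a‖ ≤ M) :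
    ContinuousOn (fun z => ∫ a, f z a ∂μ) disk := by
  intro z hz
  rw [mem_ball_zero_iff] at hz
  obtain ⟨r, hzr, hr⟩ := exists_between hz
  obtain ⟨M, hM⟩ := hb r hr
  have : ContinuousOn (fun z => ∫ a, f z a ∂μ) (Metric.ball 0 r) :=
    continuousOn_of_dominated (bound := fun _ => M) (fun w _ => hm w)
      (fun w hw => .of_forall fun a => hM w a (mem_ball_zero_iff.1 hw).le) (integrable_const _)
      (.of_forall fun a => (hc a).mono (Metric.ball_subset_ball hr.le))
  exact (this.continuousAt (Metric.isOpen_ball.mem_nhds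
    (mem_ball_zero_iff.2 hzr))).continuousWithinAt

theorem spectralKernel_self_re (F : Measure Torus) (z : ℂ) :
    (spectralKernel F z z).re = ∫ t, ‖szego z t‖ ^ 2 ∂F := by
  simp only [spectralKernel, Complex.mul_conj, Complex.normSq_eq_norm_sq]
  rw [integral_complex_ofReal, Complex.ofReal_re]

theorem spectralKernel_self_re_pos (F : Measure Torus) [IsProbabilityMeasure F] {z : ℂ}
    (hz : z ∈ disk) : 0 < (spectralKernel F z z).re := by
  rw [spectralKernel_self_re]
  have : ∫ _ : Torus, (1 / 4 : ℝ) ∂F ≤ ∫ t, ‖szego z t‖ ^ 2 ∂F := by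
    refine integral_mono (integrable_const _)
      ((memLp_szego F hz 2).integrable_norm_pow two_ne_zero) fun t => ?_
    have := (half_le_re_szego hz t).trans (Complex.re_le_norm _)
    simp only
    nlinarith
  simp only [integral_const, probReal_univ, smul_eq_mul, one_mul] at this
  linarith

/-- The double integral `∫∫ |e^{-it} - e^{-iu}|² |s(z,t) s(z,u)|⁴ F(dt) F(du)`. -/
def wronskianIntegral (F : Measure Torus) (z : ℂ) : ℝ :=
  ∫ p : Torus × Torus,
    ‖expNeg p.1 - expNeg p.2‖ ^ 2 * ‖szego z p.1 * szego z p.2‖ ^ 4 ∂(F.prod F)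

theorem continuousOn_wronskianIntegral (F : Measure Torus) [IsFiniteMeasure F] :
    ContinuousOn (wronskianIntegral F) disk := by
  refine continuousOn_integral_of_forall_bound (fun z => by fun_prop) (fun p => ?_) fun r hr => ?_
  · exact continuousOn_const.mul
      ((((continuousOn_szego p.1).mul (continuousOn_szego p.2)).norm).pow 4)
  · refine ⟨2 ^ 2 * (1 / (1 - r) * (1 / (1 - r))) ^ 4, fun z p hz => ?_⟩
    have : 0 < 1 - r := sub_pos.2 hr
    rw [norm_mul, norm_pow, norm_pow, norm_norm, norm_norm, norm_mul]
    gcongr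
    · refine (norm_sub_le _ _).trans ?_
      rw [norm_expNeg, norm_expNeg]
      norm_num
    · exact norm_szego_le hz hr _
    · exact norm_szego_le hz hr _

theorem continuousOn_spectralKernel_self_re (F : Measure Torus) [IsFiniteMeasure F] :
    ContinuousOn (fun z => (spectralKernel F z z).re) disk := by
  simp_rw [spectralKernel_self_re]
  refine continuousOn_integral_of_forall_bound (fun z => by fun_prop)
    (fun t => ((continuousOn_szego t).norm).pow 2) fun r hr => ?_
  refine ⟨(1 / (1 - r)) ^ 2, fun z t hz => ?_⟩
  rw [norm_pow, norm_norm]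
  gcongr
  exact norm_szego_le hz hr t

/-- Lagrange's identity for a Gram determinant: expanding the square yields each term twice, whence
the factor 1/2. -/
theorem integral_norm_sq_mul_sub_norm_sq {S : Type*} [MeasurableSpace S] {F : Measure S}
    [IsFiniteMeasure F] {f g : S → ℂ} (hf : MemLp f 2 F) (hg : MemLp g 2 F) :
    (∫ t, ‖f t‖ ^ 2 ∂F) * (∫ t, ‖g t‖ ^ 2 ∂F) - ‖∫ t, f t * conj (g t) ∂F‖ ^ 2 =
      (∫ p : S × S, ‖f p.1 * g p.2 - f p.2 * g p.1‖ ^ 2 ∂(F.prod F)) / 2 := by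
  have hff := hf.integrable_norm_pow two_ne_zero
  have hgg := hg.integrable_norm_pow two_ne_zero
  have ifg : Integrable (fun t => f t * conj (g t)) F := hf.integrable_mul (memLp_conj hg)
  have igf : Integrable (fun t => conj (f t * conj (g t))) F := by
    simpa [Pi.mul_def] using (memLp_conj hf).integrable_mul hg
  have i1 := hff.mul_prod hgg
  have i2 := hgg.mul_prod hff
  have i3 := (ifg.mul_prod igf).const_mul 2
  have i3' := i3.re
  have e3 := integral_re (𝕜 := ℂ) i3
  simp only [RCLike.re_to_complex] at e3 i3'
  have hsplit : ∀ p : S × S, ‖f p.1 * g p.2 - f p.2 * g p.1‖ ^ 2 =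
      ‖f p.1‖ ^ 2 * ‖g p.2‖ ^ 2 + ‖g p.1‖ ^ 2 * ‖f p.2‖ ^ 2 -
        (2 * (f p.1 * conj (g p.1) * conj (f p.2 * conj (g p.2)))).re := by
    intro p
    simp only [← Complex.normSq_eq_norm_sq, Complex.normSq_apply]
    simp
    ring
  simp_rw [hsplit]
  have p1 : ∫ p : S × S, ‖f p.1‖ ^ 2 * ‖g p.2‖ ^ 2 ∂(F.prod F) =
      (∫ t, ‖f t‖ ^ 2 ∂F) * ∫ t, ‖g t‖ ^ 2 ∂F :=
    integral_prod_mul (fun t => ‖f t‖ ^ 2) (fun t => ‖g t‖ ^ 2)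
  have p2 : ∫ p : S × S, ‖g p.1‖ ^ 2 * ‖f p.2‖ ^ 2 ∂(F.prod F) =
      (∫ t, ‖g t‖ ^ 2 ∂F) * ∫ t, ‖f t‖ ^ 2 ∂F :=
    integral_prod_mul (fun t => ‖g t‖ ^ 2) (fun t => ‖f t‖ ^ 2)
  have p3 : ∫ p : S × S, f p.1 * conj (g p.1) * conj (f p.2 * conj (g p.2)) ∂(F.prod F) =
      (∫ t, f t * conj (g t) ∂F) * ∫ t, conj (f t * conj (g t)) ∂F :=
    integral_prod_mul (fun t => f t * conj (g t)) (fun t => conj (f t * conj (g t)))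
  rw [integral_sub (by fun_prop) i3', integral_add i1 i2, e3, integral_const_mul, p1, p2, p3,
    integral_conj, Complex.mul_conj']
  norm_cast
  ring

/-! ### The normalized increments `X(z) / K(z,0) - X(0)` -/

/-- `Y(z) / ∫ s(z,t) F(dt) - Y(0)`. -/
def increment (F : Measure Torus) {β : Type*} (Y : ℂ → β → ℂ) (z : ℂ) (b : β) : ℂ :=
  (szegoMean F z)⁻¹ * Y z b + (-1) * Y 0 b

/-- The derivative in `z` of `increment F szego z t`. -/
def incrementDeriv (F : Measure Torus) (z : ℂ) (t : Torus) : ℂ :=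
  -(∫ u, expNeg u * szego z u ^ 2 ∂F) / szegoMean F z ^ 2 * szego z t +
    (szegoMean F z)⁻¹ * (expNeg t * szego z t ^ 2)

theorem hasDerivAt_increment_szego (F : Measure Torus) [IsProbabilityMeasure F] {z : ℂ}
    (hz : z ∈ disk) (t : Torus) :
    HasDerivAt (fun z => increment F szego z t) (incrementDeriv F z t) z :=
  (((hasDerivAt_szegoMean F hz).inv (szegoMean_ne_zero F hz)).mul
    (hasDerivAt_szego hz t)).add_const _

theorem memLp_expNeg_mul_szego_sq (F : Measure Torus) [IsFiniteMeasure F] {z : ℂ} (hz : z ∈ disk)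
    (p : ℝ≥0∞) : MemLp (fun t => expNeg t * szego z t ^ 2) p F := by
  rw [mem_ball_zero_iff] at hz
  refine MemLp.of_bound (by fun_prop) ((1 / (1 - ‖z‖)) ^ 2) (.of_forall fun t => ?_)
  rw [norm_mul, norm_expNeg, one_mul, norm_pow]
  gcongr
  exact norm_szego_le le_rfl hz t

theorem memLp_incrementDeriv (F : Measure Torus) [IsFiniteMeasure F] {z : ℂ} (hz : z ∈ disk)
    (p : ℝ≥0∞) : MemLp (incrementDeriv F z) p F :=
  ((memLp_szego F hz p).const_mul _).add ((memLp_expNeg_mul_szego_sq F hz p).const_mul _)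

theorem exists_norm_incrementDeriv_le (F : Measure Torus) [IsProbabilityMeasure F] {r : ℝ}
    (hr : r < 1) : ∃ M, ∀ z t, ‖z‖ ≤ r → ‖incrementDeriv F z t‖ ≤ M := by
  have hr' : 0 < 1 - r := sub_pos.2 hr
  -- The triangle inequality, with |s| ≤ 1/(1-r), |s'| ≤ 1/(1-r)² and |m| ≥ 1/2.
  refine ⟨(1 / (1 - r)) ^ 2 / (1 / 2) ^ 2 * (1 / (1 - r)) + (1 / 2)⁻¹ * (1 / (1 - r)) ^ 2,
    fun z t hz => ?_⟩
  have hm := half_le_norm_szegoMean F (mem_ball_zero_iff.2 (hz.trans_lt hr))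
  have hs : ∀ u, ‖expNeg u * szego z u ^ 2‖ ≤ (1 / (1 - r)) ^ 2 := by
    intro u
    rw [norm_mul, norm_expNeg, one_mul, norm_pow]
    gcongr
    exact norm_szego_le hz hr u
  have hint : ‖∫ u, expNeg u * szego z u ^ 2 ∂F‖ ≤ (1 / (1 - r)) ^ 2 := by
    simpa using norm_integral_le_of_norm_le_const (μ := F) (.of_forall hs)
  refine (norm_add_le _ _).trans (add_le_add ?_ ?_)
  · rw [norm_mul, norm_div, norm_neg, norm_pow]
    gcongr
    exact norm_szego_le hz hr t
  · rw [norm_mul, norm_inv]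
    gcongr
    exact hs t

theorem integral_incrementDeriv (F : Measure Torus) [IsProbabilityMeasure F] {z : ℂ}
    (hz : z ∈ disk) : ∫ t, incrementDeriv F z t ∂F = 0 := by
  have h0 := szegoMean_ne_zero F hz
  have i1 := (memLp_szego F hz 1).integrable le_rfl
  have i2 := (memLp_expNeg_mul_szego_sq F hz 1).integrable le_rfl
  simp only [incrementDeriv]
  rw [integral_add (i1.const_mul _) (i2.const_mul _), integral_const_mul, integral_const_mul,
    ← szegoMean]
  field_simp
  ring

theorem memLp_normalized_szego (F : Measure Torus) [IsFiniteMeasure F] {z : ℂ} (hz : z ∈ disk)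
    (p : ℝ≥0∞) : MemLp (fun t => (szegoMean F z)⁻¹ * szego z t) p F :=
  (memLp_szego F hz p).const_mul _

/-- Pythagoras: s/m is the constant 1 plus a mean-zero increment. The 1 contributed by the Gaussian
weight is thus absorbed into ‖s/m‖². -/
theorem one_add_integral_norm_increment_szego_sq (F : Measure Torus) [IsProbabilityMeasure F]
    {z : ℂ} (hz : z ∈ disk) :
    1 + ∫ t, ‖increment F szego z t‖ ^ 2 ∂F =
      ∫ t, ‖(szegoMean F z)⁻¹ * szego z t‖ ^ 2 ∂F := by
  have h0 := szegoMean_ne_zero F hz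
  have i1 := (memLp_normalized_szego F hz 1).integrable le_rfl
  have i2 := (memLp_normalized_szego F hz 2).integrable_norm_pow two_ne_zero
  have e := integral_re (𝕜 := ℂ) i1
  have i1' := i1.re
  simp only [RCLike.re_to_complex] at e i1'
  have hsplit : ∀ t, ‖increment F szego z t‖ ^ 2 = ‖(szegoMean F z)⁻¹ * szego z t‖ ^ 2 -
      2 * ((szegoMean F z)⁻¹ * szego z t).re + 1 := by
    intro t
    rw [increment, szego_zero]
    generalize (szegoMean F z)⁻¹ * szego z t = u
    simp only [← Complex.normSq_eq_norm_sq, Complex.normSq_apply]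
    simp
    ring
  simp_rw [hsplit]
  rw [integral_add (by fun_prop) (integrable_const _), integral_sub i2 (i1'.const_mul _),
    integral_const_mul, e, integral_const_mul, ← szegoMean, inv_mul_cancel₀ h0]
  simp
  ring

theorem integral_incrementDeriv_mul_conj (F : Measure Torus) [IsProbabilityMeasure F]
    {z : ℂ} (hz : z ∈ disk) :
    ∫ t, incrementDeriv F z t * conj (increment F szego z t) ∂F =
      ∫ t, incrementDeriv F z t * conj ((szegoMean F z)⁻¹ * szego z t) ∂F := by
  have i1 := (memLp_incrementDeriv F hz 1).integrable le_rfl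
  have i2 : Integrable (fun t => incrementDeriv F z t * conj ((szegoMean F z)⁻¹ * szego z t)) F :=
    (memLp_incrementDeriv F hz 2).integrable_mul (memLp_conj (memLp_normalized_szego F hz 2))
  have hsplit : ∀ t, incrementDeriv F z t * conj (increment F szego z t) =
      incrementDeriv F z t * conj ((szegoMean F z)⁻¹ * szego z t) - incrementDeriv F z t := by
    intro t
    rw [increment, szego_zero]
    simp
    ring
  simp_rw [hsplit]
  rw [integral_sub i2 i1, integral_incrementDeriv F hz, sub_zero]

/-- Writing G = s/m, the left side is (‖G'‖²‖G‖² - |⟨G',G⟩|²)/‖G‖⁴, to which Lagrange's identity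
applies. In the Wronskian the terms with m' cancel, leaving 1/m², and the powers of |m| cancel
against ‖G‖⁴ = K²/|m|⁴. -/
theorem increment_energy (F : Measure Torus) [IsProbabilityMeasure F] {z : ℂ} (hz : z ∈ disk) :
    (∫ t, ‖incrementDeriv F z t‖ ^ 2 ∂F) / (1 + ∫ t, ‖increment F szego z t‖ ^ 2 ∂F) -
      ‖∫ t, incrementDeriv F z t * conj (increment F szego z t) ∂F‖ ^ 2 /
        (1 + ∫ t, ‖increment F szego z t‖ ^ 2 ∂F) ^ 2 =
      wronskianIntegral F z / (2 * (spectralKernel F z z).re ^ 2) := by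
  have h0 := szegoMean_ne_zero F hz
  have hK := spectralKernel_self_re_pos F hz
  have hL := integral_norm_sq_mul_sub_norm_sq (memLp_incrementDeriv F hz 2)
    (memLp_normalized_szego F hz 2)
  have hg : ∫ t, ‖(szegoMean F z)⁻¹ * szego z t‖ ^ 2 ∂F =
      (spectralKernel F z z).re / ‖szegoMean F z‖ ^ 2 := by
    simp_rw [norm_mul, mul_pow]
    rw [integral_const_mul, ← spectralKernel_self_re, norm_inv]
    field_simp
  have hW : ∫ p : Torus × Torus, ‖incrementDeriv F z p.1 * ((szegoMean F z)⁻¹ * szego z p.2) -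
      incrementDeriv F z p.2 * ((szegoMean F z)⁻¹ * szego z p.1)‖ ^ 2 ∂(F.prod F) =
      wronskianIntegral F z / ‖szegoMean F z‖ ^ 4 := by
    rw [wronskianIntegral, ← integral_div]
    refine integral_congr_ae (.of_forall fun p => ?_)
    simp only
    have e1 : expNeg p.1 * szego z p.1 ^ 2 * szego z p.2 -
        expNeg p.2 * szego z p.2 ^ 2 * szego z p.1 =
        (expNeg p.1 - expNeg p.2) * (szego z p.1 * szego z p.2) ^ 2 := by
      have h1 := one_sub_mul_expNeg_ne_zero hz p.1
      have h2 := one_sub_mul_expNeg_ne_zero hz p.2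
      simp only [szego]
      field_simp
      ring
    have e2 : incrementDeriv F z p.1 * ((szegoMean F z)⁻¹ * szego z p.2) -
        incrementDeriv F z p.2 * ((szegoMean F z)⁻¹ * szego z p.1) =
        (expNeg p.1 - expNeg p.2) * (szego z p.1 * szego z p.2) ^ 2 / szegoMean F z ^ 2 := by
      rw [← e1]
      simp only [incrementDeriv]
      field_simp
      ring
    rw [e2, norm_div, norm_mul, norm_pow, norm_pow]
    ring
  rw [hW, hg] at hL
  rw [one_add_integral_norm_increment_szego_sq F hz, integral_incrementDeriv_mul_conj F hz, hg]
  have h0' : 0 < ‖szegoMean F z‖ := norm_pos_iff.2 h0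
  field_simp at hL ⊢
  linear_combination hL

/-! ### The weighted moment of the derivative of the random increment. -/

theorem isSpectral_increment {Ω : Type*} [MeasurableSpace Ω] {P : Measure Ω} {F : Measure Torus}
    {X : ℂ → Ω → ℂ} (hX : IsSpectral P F (fun z : disk => X z) (fun z : disk => szego z)) :
    IsSpectral P F (fun z : disk => increment F X z) (fun z : disk => increment F szego z) :=
  hX.lin_comb (fun z : disk => (szegoMean F z)⁻¹) (fun _ => -1) (fun z => z) (fun _ => ⟨0, by simp⟩)

theorem differentiableOn_increment (F : Measure Torus) [IsProbabilityMeasure F] {β : Type*}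
    {Y : ℂ → β → ℂ} {b : β} (hY : DifferentiableOn ℂ (fun z => Y z b) disk) :
    DifferentiableOn ℂ (fun z => increment F Y z b) disk := fun _ hz =>
  (((((hasDerivAt_szegoMean F hz).inv (szegoMean_ne_zero F hz)).differentiableAt).mul
    (hY.differentiableAt (Metric.isOpen_ball.mem_nhds hz))).add_const _).differentiableWithinAt

theorem exists_seq_tendsto_zero_add_mem_ball {z : ℂ} {r : ℝ} (hzr : ‖z‖ < r) :
    ∃ δ : ℕ → ℂ, (∀ n, δ n ≠ 0) ∧ (∀ n, z + δ n ∈ Metric.ball (0 : ℂ) r) ∧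
      Filter.Tendsto δ Filter.atTop (nhdsWithin 0 {0}ᶜ) := by
  -- The shift n + 2 keeps the factor below 1 already at n = 0, so every z + δ n lies in the open
  -- ball.
  let δ : ℕ → ℂ := fun n => (((r - ‖z‖) * (1 / ((n : ℝ) + 2)) : ℝ) : ℂ)
  have hδpos : ∀ n : ℕ, 0 < (r - ‖z‖) * (1 / ((n : ℝ) + 2)) := fun n =>
    mul_pos (sub_pos.2 hzr) (one_div_pos.2 (by positivity))
  have hδ0 : ∀ n, δ n ≠ 0 := fun n => Complex.ofReal_ne_zero.2 (hδpos n).ne'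
  have hδball : ∀ n, z + δ n ∈ Metric.ball (0 : ℂ) r := by
    intro n
    rw [mem_ball_zero_iff]
    refine (norm_add_le _ _).trans_lt ?_
    rw [Complex.norm_real, Real.norm_eq_abs, abs_of_pos (hδpos n)]
    have : 1 / ((n : ℝ) + 2) < 1 := by
      rw [div_lt_one (by positivity)]
      linarith [n.cast_nonneg (α := ℝ)]
    nlinarith
  have hδ : Filter.Tendsto δ Filter.atTop (nhdsWithin 0 {0}ᶜ) := by
    refine tendsto_nhdsWithin_iff.2 ⟨?_, .of_forall hδ0⟩
    have : Filter.Tendsto (fun n : ℕ => (r - ‖z‖) * (1 / ((n : ℝ) + 2))) Filter.atTop (nhds 0) := by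
      have h1 := ((Filter.tendsto_add_atTop_iff_nat 1).2
        (tendsto_one_div_add_atTop_nhds_zero_nat (𝕜 := ℝ))).const_mul (r - ‖z‖)
      rw [mul_zero] at h1
      refine h1.congr fun n => ?_
      push_cast
      ring
    have h2 := (Complex.continuous_ofReal.tendsto 0).comp this
    rwa [Complex.ofReal_zero] at h2
  exact ⟨δ, hδ0, hδball, hδ⟩

theorem IsSpectral.lintegral_norm_sq_mul_exp_of_tendsto_slope {Ω S T : Type*} [MeasurableSpace Ω]
    [MeasurableSpace S] {P : Measure Ω} {F : Measure S} [IsFiniteMeasure F] {Z : T → Ω → ℂ}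
    {φ : T → S → ℂ} (h : IsSpectral P F Z φ) (i : T) (j : ℕ → T) (c : ℕ → ℂ) {Y : Ω → ℂ}
    {ψ : S → ℂ} {M : ℝ} (hM : ∀ n t, ‖c n * φ (j n) t + -c n * φ i t‖ ≤ M)
    (hφ : ∀ t, Filter.Tendsto (fun n => c n * φ (j n) t + -c n * φ i t) Filter.atTop (nhds (ψ t)))
    (hY : ∀ᵐ ω ∂P, Filter.Tendsto (fun n => c n * Z (j n) ω + -c n * Z i ω) Filter.atTop
      (nhds (Y ω))) :
    ∫⁻ ω, ENNReal.ofReal (‖Y ω‖ ^ 2 * Real.exp (-‖Z i ω‖ ^ 2)) ∂P =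
      ENNReal.ofReal ((∫ t, ‖ψ t‖ ^ 2 ∂F) / (1 + ∫ t, ‖φ i t‖ ^ 2 ∂F) -
        ‖∫ t, ψ t * conj (φ i t) ∂F‖ ^ 2 / (1 + ∫ t, ‖φ i t‖ ^ 2 ∂F) ^ 2) := by
  -- Index `none` is `Z i`, which carries the weight; index `some n` is the n-th difference
  -- quotient.
  have hW := h.lin_comb (T' := Option ℕ) (fun k => k.elim 1 c) (fun k => k.elim 0 fun n => -c n)
    (fun k => k.elim i j) (fun _ => i)
  have key := hW.lintegral_norm_sq_mul_exp_of_tendsto (M := M) none some (Y := Y) (ψ := ψ) hM hφ hY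
  simpa only [Option.elim_none, one_mul, zero_mul, add_zero] using key

theorem lintegral_norm_deriv_increment_sq_mul_exp {Ω : Type*} [MeasurableSpace Ω] {P : Measure Ω}
    {F : Measure Torus} [IsProbabilityMeasure F] {X : ℂ → Ω → ℂ}
    (hX : IsSpectral P F (fun z : disk => X z) (fun z : disk => szego z))
    (hd : ∀ᵐ ω ∂P, DifferentiableOn ℂ (fun z => X z ω) disk) {z : ℂ} (hz : z ∈ disk) :
    ∫⁻ ω, ENNReal.ofReal (‖deriv (fun z => increment F X z ω) z‖ ^ 2 *
        Real.exp (-‖increment F X z ω‖ ^ 2)) ∂P =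
      ENNReal.ofReal (wronskianIntegral F z / (2 * (spectralKernel F z z).re ^ 2)) := by
  have hz' : ‖z‖ < 1 := mem_ball_zero_iff.1 hz
  obtain ⟨r, hzr, hr⟩ := exists_between hz'
  obtain ⟨M, hM⟩ := exists_norm_incrementDeriv_le F hr
  have hball : Metric.ball (0 : ℂ) r ⊆ disk := Metric.ball_subset_ball hr.le
  obtain ⟨δ, hδ0, hδball, hδ⟩ := exists_seq_tendsto_zero_add_mem_ball hzr
  let zn : ℕ → disk := fun n => ⟨z + δ n, hball (hδball n)⟩
  have hslope : ∀ {f : ℂ → ℂ} {f' : ℂ}, HasDerivAt f f' z → Filter.Tendsto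
      (fun n => (δ n)⁻¹ * f (z + δ n) + -(δ n)⁻¹ * f z) Filter.atTop (nhds f') := by
    intro f f' hf
    refine (hf.tendsto_slope_zero.comp hδ).congr fun n => ?_
    simp only [Function.comp_apply, smul_eq_mul]
    ring
  have hM' : ∀ n t, ‖(δ n)⁻¹ * increment F szego (zn n) t +
      -(δ n)⁻¹ * increment F szego z t‖ ≤ M := by
    intro n t
    -- The mean value inequality bounds all difference quotients by the bound on the derivative,
    -- uniformly in t.
    have := (convex_ball (0 : ℂ) r).norm_image_sub_le_of_norm_hasDerivWithin_le
      (fun w hw => (hasDerivAt_increment_szego F (hball hw) t).hasDerivWithinAt)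
      (fun w hw => hM w t (mem_ball_zero_iff.1 hw).le) (mem_ball_zero_iff.2 hzr) (hδball n)
    rw [add_sub_cancel_left] at this
    rw [neg_mul, ← sub_eq_add_neg, ← mul_sub, norm_mul, norm_inv, inv_mul_le_iff₀
      (norm_pos_iff.2 (hδ0 n)), mul_comm]
    exact this
  have hY : ∀ᵐ ω ∂P, Filter.Tendsto (fun n => (δ n)⁻¹ * increment F X (zn n) ω +
      -(δ n)⁻¹ * increment F X z ω) Filter.atTop
      (nhds (deriv (fun z => increment F X z ω) z)) := by
    filter_upwards [hd] with ω hω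
    have h1 : HasDerivAt (fun z => increment F X z ω) (deriv (fun z => increment F X z ω) z) z :=
      ((differentiableOn_increment F (Y := X) (b := ω) hω).differentiableAt
        (Metric.isOpen_ball.mem_nhds hz)).hasDerivAt
    exact hslope (f := fun z => increment F X z ω) h1
  have hφ : ∀ t, Filter.Tendsto (fun n => (δ n)⁻¹ * increment F szego (zn n) t +
      -(δ n)⁻¹ * increment F szego z t) Filter.atTop (nhds (incrementDeriv F z t)) := fun t =>
    hslope (f := fun z => increment F szego z t) (hasDerivAt_increment_szego F hz t)
  rw [← increment_energy F hz]
  exact (isSpectral_increment hX).lintegral_norm_sq_mul_exp_of_tendsto_slope ⟨z, hz⟩ zn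
    (fun n => (δ n)⁻¹) hM' hφ hY

/-! ### Random holomorphic functions -/

theorem measurable_uncurry_indicator_disk {α : Type*} [MeasurableSpace α] {V : α → ℂ → ℂ}
    (hd : ∀ a, ContinuousOn (V a) disk) (hm : ∀ z ∈ disk, Measurable fun a => V a z) :
    Measurable fun p : α × ℂ => disk.indicator (V p.1) p.2 := by
  have hs : MeasurableSet {p : α × ℂ | p.2 ∈ disk} :=
    measurable_snd Metric.isOpen_ball.measurableSet
  have h := measurable_uncurry_of_continuous_of_measurable (u := fun (z : disk) a => V a z)
    (fun a => continuousOn_iff_continuous_domRestrict.1 (hd a)) (fun z => hm z z.2)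
  refine measurable_of_restrict_of_restrict_compl hs ?_ ?_
  · have h2 : Measurable fun p : {p : α × ℂ | p.2 ∈ disk} => ((⟨p.1.2, p.2⟩ : disk), p.1.1) := by
      fun_prop
    convert! h.comp h2 using 1
    ext p
    exact indicator_of_mem (s := disk) p.2 _
  · convert! (measurable_const (a := (0 : ℂ))) using 1
    ext p
    exact indicator_of_notMem (s := disk) p.2 _

theorem measurable_uncurry_indicator_deriv {α : Type*} [MeasurableSpace α] {V : α → ℂ → ℂ}
    (hd : ∀ a, DifferentiableOn ℂ (V a) disk) (hm : ∀ z ∈ disk, Measurable fun a => V a z) :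
    Measurable fun p : α × ℂ => disk.indicator (deriv (V p.1)) p.2 := by
  have hV := measurable_uncurry_indicator_disk (fun a => (hd a).continuousOn) hm
  have hs : MeasurableSet {p : α × ℂ | p.2 ∈ disk} :=
    measurable_snd Metric.isOpen_ball.measurableSet
  let δ : ℕ → ℂ := fun n => 1 / ((n : ℂ) + 1)
  have hδ0 : ∀ n, δ n ≠ 0 := fun n => one_div_ne_zero (Nat.cast_add_one_ne_zero n)
  have hδ' : Filter.Tendsto δ Filter.atTop (nhds 0) := tendsto_one_div_add_atTop_nhds_zero_nat
  have hδ : Filter.Tendsto δ Filter.atTop (nhdsWithin 0 {0}ᶜ) :=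
    tendsto_nhdsWithin_iff.2 ⟨hδ', .of_forall hδ0⟩
  -- For small n the point z + δ n may leave the disk and the indicator returns 0 there; this does
  -- not affect the limit.
  refine measurable_of_tendsto_metrizable (f := fun n => {p : α × ℂ | p.2 ∈ disk}.indicator fun p =>
    (δ n)⁻¹ * (disk.indicator (V p.1) (p.2 + δ n) - disk.indicator (V p.1) p.2))
    (fun n => ?_) (tendsto_pi_nhds.2 fun p => ?_)
  · refine Measurable.indicator (measurable_const.mul (Measurable.sub ?_ hV)) hs
    exact hV.comp (measurable_fst.prodMk (measurable_snd.add_const _))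
  · by_cases hp : p.2 ∈ disk
    · have hnhds := Metric.isOpen_ball.mem_nhds hp
      have h1 := (((hd p.1).differentiableAt hnhds).hasDerivAt.tendsto_slope_zero.comp hδ)
      rw [indicator_of_mem hp]
      refine h1.congr' ?_
      have h2 : Filter.Tendsto (fun n => p.2 + δ n) Filter.atTop (nhds p.2) := by
        simpa using hδ'.const_add p.2
      filter_upwards [h2.eventually hnhds] with n hn
      rw [indicator_of_mem (s := {p : α × ℂ | p.2 ∈ disk}) hp, indicator_of_mem hp,
        indicator_of_mem (s := disk) hn]
      rfl
    · simp only [indicator_of_notMem hp]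
      exact tendsto_const_nhds.congr fun n =>
        (indicator_of_notMem (s := {p : α × ℂ | p.2 ∈ disk}) hp _).symm

/-- The mean number of zeros of `V + ζ` for a random holomorphic function `V` and an independent
random variable `ζ` with density `p`. -/
theorem lintegral_zeroCount_add_of_indepFun {Ω Ω' : Type*} [MeasurableSpace Ω]
    [mΩ' : MeasurableSpace Ω'] {P : Measure Ω} [IsProbabilityMeasure P] {ζ : Ω → ℂ} {q : Ω → Ω'}
    (hζ : Measurable ζ) (hq : Measurable q) (hind : IndepFun ζ q P) {p : ℂ → ℝ≥0∞}
    (hp : Measurable p) (hζp : P.map ζ = volume.withDensity p) {V : Ω' → ℂ → ℂ}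
    (hd : ∀ a, DifferentiableOn ℂ (V a) disk) (hm : ∀ z ∈ disk, Measurable fun a => V a z)
    {B : Set ℂ} (hB : MeasurableSet B) (hBd : B ⊆ disk) :
    ∫⁻ ω, zeroCount (fun z => V (q ω) z + ζ ω) B ∂P =
      ∫⁻ z in B, ∫⁻ ω, ‖deriv (V (q ω)) z‖ₑ ^ 2 * p (-V (q ω) z) ∂P := by
  have hΦ : Measurable fun x : ℂ × Ω' => zeroCount (fun z => V x.2 z + x.1) B :=
    measurable_zeroCount (f := fun (x : ℂ × Ω') z => V x.2 z + x.1)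
      (fun x => (hd x.2).add_const _)
      (fun z hz => ((hm z hz).comp measurable_snd).add measurable_fst) hB
  have hpair := (indepFun_iff_map_prod_eq_prod_map_map hζ.aemeasurable hq.aemeasurable).1 hind
  have : IsProbabilityMeasure (P.map q) := Measure.isProbabilityMeasure_map hq.aemeasurable
  have : IsProbabilityMeasure (P.map ζ) := Measure.isProbabilityMeasure_map hζ.aemeasurable
  -- For a frozen path, the zeros of V + w are the fiber of -V over w, so the area formula applies
  -- to -V.
  have hinner : ∀ a, ∫⁻ w, zeroCount (fun z => V a z + w) B ∂(P.map ζ) =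
      ∫⁻ z in B, ‖deriv (V a) z‖ₑ ^ 2 * p (-V a z) := by
    intro a
    have hmeas : Measurable fun w => zeroCount (fun z => V a z + w) B :=
      measurable_zeroCount (f := fun w z => V a z + w) (fun w => (hd a).add_const w)
        (fun z _ => measurable_const.add measurable_id) hB
    rw [hζp, lintegral_withDensity_eq_lintegral_mul _ hp hmeas]
    have h := lintegral_mul_encard_fiber (φ := fun z => -V a z) Metric.isOpen_ball
      (hd a).neg hB hBd hp
    simp only [deriv.fun_neg, enorm_neg] at h
    rw [← h]
    refine lintegral_congr fun w => ?_
    have hset : {z : ℂ | z ∈ disk ∧ V a z + w = 0} ∩ B = B ∩ {z | -V a z = w} := by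
      ext z
      simp only [mem_inter_iff, mem_ofPred_eq, neg_eq_iff_add_eq_zero]
      exact ⟨fun h => ⟨h.2, h.1.2⟩, fun h => ⟨⟨hBd h.1, h.2⟩, h.1⟩⟩
    simp only [Pi.mul_apply, zeroCount, hset]
  have hVm := measurable_uncurry_indicator_disk (fun a => (hd a).continuousOn) hm
  have hDm := measurable_uncurry_indicator_deriv hd hm
  have hJ : Measurable fun x : Ω' × ℂ => ‖disk.indicator (deriv (V x.1)) x.2‖ₑ ^ 2 *
      p (-disk.indicator (V x.1) x.2) := (hDm.enorm.pow_const 2).mul (hp.comp hVm.neg)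
  have hJB : ∀ z ∈ B, ∀ a, ‖deriv (V a) z‖ₑ ^ 2 * p (-V a z) =
      ‖disk.indicator (deriv (V a)) z‖ₑ ^ 2 * p (-disk.indicator (V a) z) := by
    intro z hz a
    rw [indicator_of_mem (hBd hz), indicator_of_mem (hBd hz)]
  calc ∫⁻ ω, zeroCount (fun z => V (q ω) z + ζ ω) B ∂P
      = ∫⁻ x, zeroCount (fun z => V x.2 z + x.1) B ∂(P.map fun ω => (ζ ω, q ω)) :=
        (lintegral_map hΦ (hζ.prodMk hq)).symm
    _ = ∫⁻ a, ∫⁻ w, zeroCount (fun z => V a z + w) B ∂(P.map ζ) ∂(P.map q) := by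
        rw [hpair, lintegral_prod_symm _ hΦ.aemeasurable]
    _ = ∫⁻ a, (∫⁻ z in B, ‖disk.indicator (deriv (V a)) z‖ₑ ^ 2 *
          p (-disk.indicator (V a) z)) ∂(P.map q) := by
        refine lintegral_congr fun a => ?_
        rw [hinner]
        exact setLIntegral_congr_fun hB fun z hz => hJB z hz a
    _ = ∫⁻ z in B, ∫⁻ a, ‖disk.indicator (deriv (V a)) z‖ₑ ^ 2 *
          p (-disk.indicator (V a) z) ∂(P.map q) :=
        lintegral_lintegral_swap hJ.aemeasurable
    _ = _ := by
        refine setLIntegral_congr_fun hB fun z hz => ?_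
        exact (lintegral_map (hJ.comp (measurable_prodMk_right (y := z))) hq).trans
          (lintegral_congr fun ω => (hJB z hz (q ω)).symm)

/-- A holomorphic path is determined by its values on a countable dense set, so one null set takes
care of all points at once; Y is set to 0 on it. -/
theorem exists_measurable_holomorphic_version {Ω : Type*} [MeasurableSpace Ω] {P : Measure Ω}
    {X : ℂ → Ω → ℂ} (hd : ∀ᵐ ω ∂P, DifferentiableOn ℂ (fun z => X z ω) disk)
    (hm : ∀ z ∈ disk, AEMeasurable (X z) P) :
    ∃ Y : ℂ → Ω → ℂ, (∀ ω, DifferentiableOn ℂ (fun z => Y z ω) disk) ∧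
      (∀ z ∈ disk, Measurable (Y z)) ∧ ∀ᵐ ω ∂P, ∀ z, Y z ω = X z ω := by
  classical
  have : Nonempty disk := ⟨⟨0, by simp⟩⟩
  let e := TopologicalSpace.denseSeq disk
  have hm' : ∀ n, AEMeasurable (X (e n)) P := fun n => hm _ (e n).2
  have hgood : ∀ᵐ ω ∂P, DifferentiableOn ℂ (fun z => X z ω) disk ∧
      ∀ n, X (e n) ω = (hm' n).mk _ ω :=
    hd.and (ae_all_iff.2 fun n => (hm' n).ae_eq_mk)
  obtain ⟨N, hN, hNm, hN0⟩ := exists_measurable_superset_of_null (ae_iff.1 hgood)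
  have hgoodN : ∀ ω ∉ N, DifferentiableOn ℂ (fun z => X z ω) disk ∧
      ∀ n, X (e n) ω = (hm' n).mk _ ω := fun ω hω => by
    by_contra h
    exact hω (hN h)
  let Y : ℂ → Ω → ℂ := fun z ω => if ω ∈ N then 0 else X z ω
  have hYd : ∀ ω, DifferentiableOn ℂ (fun z => Y z ω) disk := by
    intro ω
    by_cases hω : ω ∈ N
    · simp only [Y, hω, if_true]
      fun_prop
    · simpa only [Y, hω, if_false] using (hgoodN ω hω).1
  have hYe : ∀ n, Measurable (Y (e n)) := by
    intro n
    have : Y (e n) = fun ω => if ω ∈ N then 0 else (hm' n).mk _ ω := by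
      ext ω
      by_cases hω : ω ∈ N
      · simp only [Y, hω, if_true]
      · simp only [Y, hω, if_false, (hgoodN ω hω).2 n]
    rw [this]
    exact Measurable.ite hNm measurable_const (hm' n).measurable_mk
  refine ⟨Y, hYd, fun z hz => ?_, ?_⟩
  · obtain ⟨u, hu, hlim⟩ := mem_closure_iff_seq_limit.1
      (TopologicalSpace.denseRange_denseSeq disk ⟨z, hz⟩)
    refine measurable_of_tendsto_metrizable (f := fun n => Y (u n)) (fun n => ?_)
      (tendsto_pi_nhds.2 fun ω => ?_)
    · obtain ⟨k, hk⟩ := hu n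
      rw [← hk]
      exact hYe k
    · have hc : Continuous fun y : disk => Y y ω :=
        continuousOn_iff_continuous_domRestrict.1 (hYd ω).continuousOn
      exact (hc.tendsto _).comp hlim
  · filter_upwards [compl_mem_ae_iff.2 hN0] with ω hω z
    exact if_neg hω

theorem zeroCount_congr {f g : ℂ → ℂ} (h : ∀ z ∈ disk, f z = 0 ↔ g z = 0) (B : Set ℂ) :
    zeroCount f B = zeroCount g B := by
  have : {z : ℂ | z ∈ disk ∧ f z = 0} = {z : ℂ | z ∈ disk ∧ g z = 0} := by
    ext z
    exact and_congr_right fun hz => h z hz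
  rw [zeroCount, zeroCount, this]

/-! ### The first intensity -/

theorem IsSpectral.congr {Ω S T : Type*} [MeasurableSpace Ω] [MeasurableSpace S] {P : Measure Ω}
    {F : Measure S} {Z Z' : T → Ω → ℂ} {φ : T → S → ℂ} (h : IsSpectral P F Z φ)
    (hZ : ∀ i, Z i =ᵐ[P] Z' i) : IsSpectral P F Z' φ where
  gaussian := h.gaussian.congr hZ
  centered i := by rw [← integral_congr_ae (hZ i), h.centered]
  circular i j := by
    rw [← h.circular i j]
    refine integral_congr_ae ?_
    filter_upwards [hZ i, hZ j] with ω hi hj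
    rw [hi, hj]
  memLp := h.memLp
  cov i j := by
    rw [← h.cov i j]
    refine integral_congr_ae ?_
    filter_upwards [hZ i, hZ j] with ω hi hj
    rw [hi, hj]

theorem IsGAF.isSpectral {Ω : Type*} [MeasurableSpace Ω] {P : Measure Ω} {F : Measure Torus}
    [IsFiniteMeasure F] {X : ℂ → Ω → ℂ} (hX : IsGAF P X)
    (hcov : ∀ z ∈ disk, ∀ w ∈ disk, covKernel P X z w = spectralKernel F z w) :
    IsSpectral P F (fun z : disk => X z) (fun z : disk => szego z) where
  gaussian := hX.gaussian
  centered z := hX.centered z z.2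
  circular z w := hX.circular z z.2 w w.2
  memLp z := memLp_szego F z.2 2
  cov z w := hcov z z.2 w w.2

theorem indepFun_increment {Ω : Type*} [MeasurableSpace Ω] {P : Measure Ω} {F : Measure Torus}
    [IsProbabilityMeasure F] {X : ℂ → Ω → ℂ}
    (hX : IsSpectral P F (fun z : disk => X z) (fun z : disk => szego z)) :
    IndepFun (X 0) (fun ω (z : disk) => increment F X z ω) P := by
  have h0 : (0 : ℂ) ∈ disk := by simp
  -- X(0) and all increments are placed in one jointly Gaussian family, so that orthogonality gives
  -- independence of X(0) from the whole process.
  have h := hX.lin_comb (T' := Unit ⊕ disk) (Sum.elim (fun _ => 1) fun z => (szegoMean F z)⁻¹)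
    (Sum.elim (fun _ => 0) fun _ => -1) (Sum.elim (fun _ => ⟨0, h0⟩) id) (fun _ => ⟨0, h0⟩)
  have h' : IsSpectral P F
      (Sum.elim (fun _ : Unit => X 0) (fun z : disk => increment F X z))
      (Sum.elim (fun _ : Unit => szego 0) (fun z : disk => increment F szego z)) := by
    convert! h using 1
    · ext k ω
      rcases k with k | k <;> simp [increment]
    · ext k t
      rcases k with k | k <;> simp [increment]
  refine (h'.indepFun_of_orthogonal fun _ z => ?_).comp (φ := fun f : Unit → ℂ => f ())
    (measurable_pi_apply ()) measurable_id
  have hi := (memLp_szego F z.2 1).integrable le_rfl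
  simp only [szego_zero, one_mul, increment]
  rw [integral_conj, integral_add (hi.const_mul _) (integrable_const _), integral_const_mul,
    ← szegoMean, inv_mul_cancel₀ (szegoMean_ne_zero F z.2)]
  simp

theorem lintegral_zeroCount_eq {Ω : Type*} [MeasurableSpace Ω] {P : Measure Ω}
    [IsProbabilityMeasure P] {F : Measure Torus} [IsProbabilityMeasure F] {X : ℂ → Ω → ℂ}
    (hX : IsSpectral P F (fun z : disk => X z) (fun z : disk => szego z))
    (hd : ∀ ω, DifferentiableOn ℂ (fun z => X z ω) disk) (hm : ∀ z ∈ disk, Measurable (X z))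
    {B : Set ℂ} (hB : MeasurableSet B) (hBd : B ⊆ disk) :
    ∫⁻ ω, zeroCount (fun z => X z ω) B ∂P = ∫⁻ z in B, ENNReal.ofReal
      (1 / (2 * Real.pi * (spectralKernel F z z).re ^ 2) * wronskianIntegral F z) := by
  have h0 : (0 : ℂ) ∈ disk := by simp
  let W : Ω → disk → ℂ := fun ω z => increment F X z ω
  have hWm : Measurable W :=
    measurable_pi_lambda _ fun z => ((hm z z.2).const_mul _).add ((hm 0 h0).const_mul _)
  have hlaw : P.map (X 0) = volume.withDensity fun w =>
      ENNReal.ofReal (1 / (Real.pi * 1) * Real.exp (-‖w‖ ^ 2 / 1)) :=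
    hX.map_eq_withDensity ⟨0, h0⟩ one_pos (by simp [szego_zero])
  -- The parameter space is Ω itself with the σ-algebra generated by the increments, and q is the
  -- identity. Unlike on the space of all functions on the disk, every parameter then gives a
  -- holomorphic path.
  have hind : @IndepFun Ω ℂ Ω _ _ (MeasurableSpace.comap W MeasurableSpace.pi) (X 0) id P := by
    have := (IndepFun_iff_Indep _ _ _).1 (indepFun_increment hX)
    refine (@IndepFun_iff_Indep _ _ _ _ _ (MeasurableSpace.comap W MeasurableSpace.pi) _ _ _).2 ?_
    rwa [MeasurableSpace.comap_id]
  have hWz : ∀ z ∈ disk, Measurable[MeasurableSpace.comap W MeasurableSpace.pi]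
      fun ω => increment F X z ω := fun z hz =>
    @Measurable.comp _ _ _ (MeasurableSpace.comap W MeasurableSpace.pi) _ _ _ _
      (measurable_pi_apply (⟨z, hz⟩ : disk)) (comap_measurable W)
  have hmain := lintegral_zeroCount_add_of_indepFun
    (mΩ' := MeasurableSpace.comap W MeasurableSpace.pi) (q := id) (hm 0 h0)
    (measurable_id'' hWm.comap_le) hind (by fun_prop) hlaw (V := fun ω z => increment F X z ω)
    (fun ω => differentiableOn_increment F (hd ω))
    hWz hB hBd
  calc ∫⁻ ω, zeroCount (fun z => X z ω) B ∂P
      = ∫⁻ ω, zeroCount (fun z => increment F X z ω + X 0 ω) B ∂P := by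
        -- V + X(0) equals X divided by the nonvanishing mean m, so the zeros agree.
        refine lintegral_congr fun ω => zeroCount_congr (fun z hz => ?_) B
        simp [increment, szegoMean_ne_zero F hz]
    _ = _ := hmain
    _ = _ := by
        refine setLIntegral_congr_fun hB fun z hz => ?_
        have hz' := hBd hz
        have hsplit : ∀ ω, ‖deriv (fun z => increment F X z ω) z‖ₑ ^ 2 *
            ENNReal.ofReal (1 / (Real.pi * 1) * Real.exp (-‖-increment F X z ω‖ ^ 2 / 1)) =
            ENNReal.ofReal (1 / Real.pi) * ENNReal.ofReal
              (‖deriv (fun z => increment F X z ω) z‖ ^ 2 *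
                Real.exp (-‖increment F X z ω‖ ^ 2)) := by
          intro ω
          rw [mul_one, div_one, norm_neg, ENNReal.ofReal_mul (by positivity),
            ENNReal.ofReal_mul (by positivity), ENNReal.ofReal_pow (norm_nonneg _), ofReal_norm]
          ring
        simp only [id, hsplit]
        rw [lintegral_const_mul' _ _ ENNReal.ofReal_ne_top,
          lintegral_norm_deriv_increment_sq_mul_exp hX (.of_forall hd) hz',
          ← ENNReal.ofReal_mul (by positivity)]
        congr 1
        have := spectralKernel_self_re_pos F hz'
        field_simp

theorem wronskianIntegral_nonneg (F : Measure Torus) (z : ℂ) : 0 ≤ wronskianIntegral F z :=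
  integral_nonneg fun p => by positivity

end GAFZeros

end

open GAFZeros in
theorem mainTheorem4 {Ω : Type*} [MeasurableSpace Ω] (P : Measure Ω) [IsProbabilityMeasure P]
    (F : Measure Torus) [IsProbabilityMeasure F]
    (X : ℂ → Ω → ℂ) (hX : IsGAF P X)
    (hcov : ∀ z ∈ disk, ∀ w ∈ disk, covKernel P X z w = spectralKernel F z w) :
    IsFirstIntensity P X (fun z : ℂ =>
      1 / (2 * Real.pi * (spectralKernel F z z).re ^ 2) *
        ∫ p : Torus × Torus,
          ‖expNeg p.1 - expNeg p.2‖ ^ 2 * ‖szego z p.1 * szego z p.2‖ ^ 4 ∂(F.prod F)) := by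
  have hS := hX.isSpectral hcov
  obtain ⟨Y, hYd, hYm, hYX⟩ := exists_measurable_holomorphic_version hX.holomorphic
    fun z hz => hX.gaussian.aemeasurable ⟨z, hz⟩
  have hSY : IsSpectral P F (fun z : disk => Y z) (fun z : disk => szego z) :=
    hS.congr fun z => hYX.mono fun ω hω => (hω z).symm
  have hcount : ∀ B, (fun ω => zeroCount (fun z => X z ω) B) =ᵐ[P]
      fun ω => zeroCount (fun z => Y z ω) B := fun B => by
    filter_upwards [hYX] with ω hω
    simp_rw [hω]
  refine ⟨fun z _ => mul_nonneg (by positivity) (wronskianIntegral_nonneg F z), ?_, ?_, ?_⟩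
  · refine ContinuousOn.mul (ContinuousOn.div continuousOn_const (continuousOn_const.mul
      ((continuousOn_spectralKernel_self_re F).pow 2)) fun z hz => ?_)
      (continuousOn_wronskianIntegral F)
    have := spectralKernel_self_re_pos F hz
    positivity
  · exact fun B hB => (measurable_zeroCount (f := fun ω z => Y z ω) hYd hYm hB).aemeasurable.congr
      (hcount B).symm
  · intro B hB hBd
    rw [lintegral_congr_ae (hcount B)]
    exact lintegral_zeroCount_eq hSY hYd hYm hB hBd
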